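/- **Setting.** Consider a finite extensive-form game with $N$ players. There are finitely many world states and actions. Play starts in a known world state $w^0$; at a non-terminal world state $w$ the players choose a joint action $a$ of legal actions (every player has at least one; a player who is not to move has a single one), and the next world state $w'$ is drawn from $\mathcal T(w,a)$; player $i$ receives a utility $\mathcal U_i$ in every world state visited and observes $\mathcal O_i(w,a,w')$. The number of rounds is bounded. A history is a sequence $h=(w^0,a^0,w^1,\dots,w^t)$ of positive-probability legal steps. An information set $s$ of player $i$ is the sequence $s=s_i(h)$ of that player's own actions and observations at a non-terminal history $h$, and the legal actions of $i$ at $h$ depend only on $s$. For a strategy profile $\pi$ let $v_i(\pi,h)$ be the expected total utility of player $i$ when play continues from $h$ under $\pi$, let $v_i(\pi)=v_i(\pi,w^0)$, and let $q_i(\pi,h,a)=v_i(\pi_{s\to a},h)$, where $s=s_i(h)$ and $\pi_{s\to a}$ is $\pi$ except that $i$ plays $a$ at $s$. **Algorithm (tabular ESCHER with oracle history values).** Fix a sampling policy $b=(b_1,\dots,b_N)$ that puts positive probability on every legal action at every information set (and none on illegal ones). Let $w(s)$ be the product of the probabilities that $b_i$ gives to player $i$'s own actions recorded in $s$. Start with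 $\hat R_i\equiv 0$; the policy $\pi_i$ is always obtained from $\hat R_i$ by regret matching: at $s$ each legal action $a$ has probability proportional to $\max\{\hat R_i(s,a),0\}$, and $\pi_i(s)$ is uniform over the legal actions if all these numbers vanish. In iterations $t=1,2,\dots$, for each player $i$, with $\pi$ the profile in force, a terminal history $z$ is drawn by letting player $i$ play $b_i$ and the others $\pi_{-i}$; then, for every information set $s$ of player $i$ on $z$ and every action $a$, $q_i(\pi,z[s],a)-v_i(\pi,z[s])$ is added to $\hat R_i(s,a)$, where $z[s]$ is the part of $z$ ending at $s$. The profile in force is either, for all players, the profile at the start of the iteration (simultaneous updates), or the current profile, containing the updates already made in this iteration (alternating updates). Write $\pi^{t,i}$ for the profile in force when player $i$ is updated in iteration $t$ (with simultaneous updates it is a profile $\pi^t$ independent of $i$). The regret accumulated by player $i$ is $$R_i^T=\max_{\hat\pi_i}\sum_{t=1}^T\Bigl(v_i(\hat\pi_i,\pi^{t,i}_{-i})-v_i(\pi^{t,i})\Bigr).$$ **Theorem.** There is a constant $C>0$ depending only on the game such that the following hold for every such sampling policy $b$ and every $p\in(0,1)$. 1. For simultaneous and for alternating updates and for every $T$,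 with probability at least $1-p$, for every player $i$, $$R_i^T\le \frac{C}{\min_s w(s)}\,\sqrt T\,\sqrt{1+\log(1/p)},$$ where $s$ ranges over the information sets of player $i$. In particular the regret is $O(\sqrt T\cdot\mathrm{polylog}(1/p))$ with constants depending on the game and the sampling policy. 2. If the game is a two-player zero-sum game and the updates are simultaneous, then for every $T\ge1$, with probability at least $1-p$, the average policy $\bar\pi$ is an $\varepsilon$-Nash equilibrium with $$\varepsilon=\Bigl(\sum_{i}\frac{C}{\min_s w(s)}\Bigr)\frac{\sqrt{1+\log(1/p)}}{\sqrt T},$$ the minimum in the $i$-th summand being over the information sets $s$ of player $i$. Here $\bar\pi_i(s,a)=\sum_t\eta_i^{\pi^t}(s)\,\pi_i^t(s,a)\big/\sum_t\eta_i^{\pi^t}(s)$, with $\eta_i^{\pi}(s)$ the product of the probabilities that $\pi_i$ gives to player $i$'s own actions recorded in $s$ (uniform over the legal actions if the denominator is $0$). -/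

import Mathlib

open scoped ENNReal

universe u v x

/-- The data of an `N`-player extensive-form game given by world states: `W` is the set of world
states, `A i` the actions and `O i` the observations of player `i`.  At every non-terminal world
state all players choose an action (a player who is not to move has a single legal action), and
`trans` (which also models chance) draws the next world state.  `horizon` bounds the number of
rounds. -/
structure GameForm (N : ℕ) (W : Type u) (A : Fin N → Type v) (O : Fin N → Type x) where
  init : W
  terminal : Set W
  legal : (i : Fin N) → W → Set (A i)
  trans : W → ((i : Fin N) → A i) → PMF W
  obs : (i : Fin N) → W → ((j : Fin N) → A j) → W → O i
  util : Fin N → W → ℝ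
  horizon : ℕ

/-- `normalizeOr f d` is the distribution proportional to `f` when `f` has positive finite total
mass, and `d` otherwise. -/
noncomputable def normalizeOr {α : Type*} (f : α → ℝ≥0∞) (d : PMF α) : PMF α :=
  open Classical in
  if h : (∑' a, f a) ≠ 0 ∧ (∑' a, f a) ≠ ∞ then PMF.normalize f h.1 h.2 else d

/-- The expectation of a real function under a discrete distribution. -/
noncomputable def expectation {α : Type*} (μ : PMF α) (f : α → ℝ) : ℝ :=
  ∑' z, (μ z).toReal * f z

/-- The distribution of a tuple of independent draws, one from each `μ i`. -/
noncomputable def independentDraws {N : ℕ} {A : Fin N → Type v} [∀ i, Fintype (A i)]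
    (μ : (i : Fin N) → PMF (A i)) : PMF ((i : Fin N) → A i) :=
  PMF.ofFintype (fun a => ∏ i, μ i (a i)) (by
    have h := Finset.prod_univ_sum (fun i : Fin N => (Finset.univ : Finset (A i)))
      (fun i a => μ i a)
    rw [Fintype.piFinset_univ] at h
    rw [← h]
    refine Finset.prod_eq_one fun i _ => ?_
    rw [← tsum_fintype (L := .unconditional _)]
    exact (μ i).tsum_coe)

/-- The two ways of scheduling the players' updates within one iteration: either all players'
updates use the strategies in force at the start of the iteration, or the players are updated one
after the other, each update using the already updated strategies of the previous players. -/
inductive UpdateOrder where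
  | simultaneous
  | alternating

namespace GameForm

variable {N : ℕ} {W : Type u} {A : Fin N → Type v} {O : Fin N → Type x}

/-- A sequence `w⁰, a⁰, w¹, a¹, …, wᵗ` starting in the initial world state, stored as the list of
its steps `(aᵏ, wᵏ⁺¹)`, most recent step first. -/
abbrev Hist (_G : GameForm N W A O) := List (((i : Fin N) → A i) × W)

/-- A sequence of actions and observations of player `i`, most recent first. -/
abbrev Info (_G : GameForm N W A O) (i : Fin N) := List (A i × O i)

/-- A behavioral strategy of player `i`. -/
abbrev Strategy (G : GameForm N W A O) (i : Fin N) := G.Info i → PMF (A i)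

/-- A strategy profile. -/
abbrev Profile (G : GameForm N W A O) := (i : Fin N) → G.Strategy i

variable (G : GameForm N W A O)

/-- The last world state of a history. -/
def world : G.Hist → W
  | [] => G.init
  | (_, w) :: _ => w

/-- The histories of the game: all steps are legal, have positive transition probability, and
start in a non-terminal world state. -/
def IsHistory : G.Hist → Prop
  | [] => True
  | (a, w) :: h => IsHistory h ∧ G.world h ∉ G.terminal ∧ (∀ i, a i ∈ G.legal i (G.world h)) ∧
      w ∈ (G.trans (G.world h) a).support

/-- The information state of player `i` at a history: the player's own actions and observations
so far. -/
def info (i : Fin N) : G.Hist → G.Info i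
  | [] => []
  | (a, w) :: h => (a i, G.obs i (G.world h) a w) :: info i h

/-- The sum of the utilities of player `i` in the world states visited by a history. -/
def totalUtil (i : Fin N) : G.Hist → ℝ
  | [] => G.util i G.init
  | (_, w) :: h => G.util i w + totalUtil i h

/-- The information sets of player `i`: the information states of non-terminal histories. -/
def infoSets (i : Fin N) : Set (G.Info i) :=
  {s | ∃ h, G.IsHistory h ∧ G.world h ∉ G.terminal ∧ G.info i h = s}

/-- The legal actions of player `i` at an information set. -/
def legalAt (i : Fin N) (s : G.Info i) : Set (A i) :=
  {a | ∃ h, G.IsHistory h ∧ G.world h ∉ G.terminal ∧ G.info i h = s ∧ a ∈ G.legal i (G.world h)}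

/-- The standing assumptions on a game: players always have a legal action before the end, the
legal actions of a player depend only on the information set, and the game ends within `horizon`
rounds. -/
structure IsGame : Prop where
  legal_nonempty : ∀ i h, G.IsHistory h → G.world h ∉ G.terminal →
    (G.legal i (G.world h)).Nonempty
  legal_info : ∀ i h h', G.IsHistory h → G.IsHistory h' →
    G.world h ∉ G.terminal → G.world h' ∉ G.terminal → G.info i h = G.info i h' →
    G.legal i (G.world h) = G.legal i (G.world h')
  finite_horizon : ∀ h, G.IsHistory h → h.length ≤ G.horizon

/-- A strategy of player `i` of the game: it plays only legal actions. -/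
def IsStrategy (i : Fin N) (σ : G.Strategy i) : Prop :=
  ∀ s ∈ G.infoSets i, ∀ a, σ s a ≠ 0 → a ∈ G.legalAt i s

/-- Fixed sampling policies: legal strategies with positive probability on every legal action. -/
def IsSamplingPolicy (b : G.Profile) : Prop :=
  ∀ i, ∀ s ∈ G.infoSets i, ∀ a, b i s a ≠ 0 ↔ a ∈ G.legalAt i s

/-- The probability with which player `i`, playing `σ`, takes the own actions recorded in `s`. -/
noncomputable def ownReach {i : Fin N} (σ : G.Strategy i) : G.Info i → ℝ≥0∞
  | [] => 1
  | (a, _) :: s => σ s a * ownReach σ s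

/-- The minimum over the information sets `s` of player `i` of the reach weight `w(s)` of the
sampling policy. -/
noncomputable def minReach (b : G.Profile) (i : Fin N) : ℝ :=
  ⨅ s : G.infoSets i, (G.ownReach (b i) s.1).toReal

section Play

variable [∀ i, Fintype (A i)]

/-- One round of play under `π` from a non-terminal history. -/
noncomputable def step (π : G.Profile) (h : G.Hist) : PMF G.Hist :=
  (independentDraws fun i => π i (G.info i h)).bind fun a =>
    (G.trans (G.world h) a).map fun w => (a, w) :: h

/-- Play for at most `n` rounds under `π` from `h`, stopping in terminal world states. -/
noncomputable def playFor (π : G.Profile) : ℕ → G.Hist → PMF G.Hist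
  | 0, h => PMF.pure h
  | n + 1, h =>
    open Classical in
    if G.world h ∈ G.terminal then PMF.pure h else (G.step π h).bind (playFor π n)

/-- The distribution of the terminal history reached from `h` under `π`. -/
noncomputable def play (π : G.Profile) (h : G.Hist) : PMF G.Hist := G.playFor π G.horizon h

/-- The history value `v_i(π, h)`. -/
noncomputable def value (i : Fin N) (π : G.Profile) (h : G.Hist) : ℝ :=
  expectation (G.play π h) (G.totalUtil i)

/-- The value `v_i(π)` of the whole game. -/
noncomputable def gameValue (i : Fin N) (π : G.Profile) : ℝ := G.value i π []

/-- The profile `π_{s → a}`: as `π`, except that player `i` plays `a` at `s`. -/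
noncomputable def playAt (π : G.Profile) (i : Fin N) (s : G.Info i) (a : A i) : G.Profile :=
  open Classical in
  Function.update π i (Function.update (π i) s (PMF.pure a))

/-- The history-action value `q_i(π, h, a)`. -/
noncomputable def qValue (i : Fin N) (π : G.Profile) (h : G.Hist) (a : A i) : ℝ :=
  G.value i (G.playAt π i (G.info i h) a) h

/-- The history `z[s]`: the part of `z` ending at the information set `s` of player `i`, if `z`
passes through `s`. -/
noncomputable def historyAt (i : Fin N) (z : G.Hist) (s : G.Info i) : Option G.Hist :=
  open Classical in
  z.tails.find? fun h => decide (G.info i h = s)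

/-- The regret estimate `r̂_i(π, s, a | z)`. -/
noncomputable def regretEstimate (i : Fin N) (π : G.Profile) (s : G.Info i) (a : A i)
    (z : G.Hist) : ℝ :=
  match G.historyAt i z s with
  | some h => G.qValue i π h a - G.value i π h
  | none => 0

end Play

section Algorithm

variable [∀ i, Fintype (A i)] [∀ i, Nonempty (A i)]

/-- The strategy that is uniform over the legal actions at every information set. -/
noncomputable def uniform (i : Fin N) : G.Strategy i := fun s =>
  normalizeOr ((G.legalAt i s).indicator 1) (PMF.pure (Classical.arbitrary (A i)))

/-- Regret matching: play every legal action with probability proportional to the positive part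
of its cumulative regret, and uniformly if there is no positive regret. -/
noncomputable def regretMatching (R : (i : Fin N) → G.Info i → A i → ℝ) : G.Profile := fun i s =>
  normalizeOr ((G.legalAt i s).indicator fun a => ENNReal.ofReal (R i s a)) (G.uniform i s)

/-- One iteration of tabular ESCHER with oracle history values and fixed sampling policy `b`,
from the table `R` of cumulative estimated regrets.  For each player `i` in turn, with `π` the
profile in force, a trajectory `z` is drawn with player `i` playing `b i` and the others playing
`π`, and the regret estimates along `z` are added to the table of player `i`.  The result is the
new table, together with the profile that was in force at the update of each player. -/
noncomputable def iteration (b : G.Profile) (o : UpdateOrder)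
    (R : (i : Fin N) → G.Info i → A i → ℝ) :
    PMF (((i : Fin N) → G.Info i → A i → ℝ) × (Fin N → G.Profile)) :=
  (List.finRange N).foldl
    (fun μ i => μ.bind fun y =>
      let π : G.Profile := match o with
        | .simultaneous => G.regretMatching R
        | .alternating => G.regretMatching y.1
      (G.play (Function.update π i (b i)) []).map fun z =>
        (Function.update y.1 i fun s a => y.1 i s a + G.regretEstimate i π s a z,
          Function.update y.2 i π))
    (PMF.pure (R, fun _ => G.regretMatching R))

/-- The random state of tabular ESCHER after `T` iterations, starting from zero regrets: the
table of cumulative estimated regrets, and the list of the `T` iterations' records, each giving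
the profile that was in force at the update of each player. -/
noncomputable def escher (b : G.Profile) (o : UpdateOrder) :
    ℕ → PMF (((i : Fin N) → G.Info i → A i → ℝ) × List (Fin N → G.Profile))
  | 0 => PMF.pure (fun _ _ _ => 0, [])
  | T + 1 => (escher b o T).bind fun y =>
      (G.iteration b o y.1).map fun y' => (y'.1, y'.2 :: y.2)

/-- The regret accumulated by player `i` over the recorded iterations, that is, the maximum over
the strategies `σ` of player `i` of `∑ₜ (v_i(σ, πᵗ_{-i}) - v_i(πᵗ))`, is at most `B`; here `πᵗ` is
the profile in force when player `i` was updated in iteration `t`. -/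
def RegretLE (i : Fin N) (L : List (Fin N → G.Profile)) (B : ℝ) : Prop :=
  ∀ σ : G.Strategy i, G.IsStrategy i σ →
    (L.map fun π => G.gameValue i (Function.update (π i) i σ) - G.gameValue i (π i)).sum ≤ B

/-- The average policy: at `s`, player `i` plays `a` with probability
`∑ₜ η_i^{πᵗ}(s) πᵗ_i(s, a) / ∑ₜ η_i^{πᵗ}(s)` (uniform if the denominator vanishes). -/
noncomputable def averagePolicy (L : List (Fin N → G.Profile)) : G.Profile := fun i s =>
  normalizeOr (fun a => (L.map fun π => G.ownReach (π i i) s * π i i s a).sum) (G.uniform i s)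

/-- `π` is an `ε`-Nash equilibrium. -/
def IsApproxNash (ε : ℝ) (π : G.Profile) : Prop :=
  ∀ i, ∀ σ : G.Strategy i, G.IsStrategy i σ →
    G.gameValue i (Function.update π i σ) ≤ G.gameValue i π + ε

/-- The game is a two-player zero-sum game. -/
def IsTwoPlayerZeroSum : Prop :=
  N = 2 ∧ ∀ π : G.Profile, (∀ i, G.IsStrategy i (π i)) → ∑ i, G.gameValue i π = 0

end Algorithm

end GameForm

/-! Fix a player `i`, a profile `π` and a deviation `σ`. The difference `v_i(σ, π_{-i}) - v_i(π)`
telescopes into expected one-step gains `q_i - v_i` along play in which `i` follows `σ`. Passing to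
play with the sampling policy `b` multiplies each gain by a ratio of own reach probabilities, which
depends only on the information set. Grouping by information sets gives `gameValue_update_sub`: the
gain is a sum over `s` of a ratio, at most `1 / min w`, times the `σ(s)`-average of the expected
ESCHER estimates. The estimates themselves carry no importance weight, so they are bounded by a
constant `M` independent of `b`.

It remains to bound the accumulated expected estimates, in two steps. On every sampled trajectory
the estimates at `s` average to zero under `π_i(s)`, so regret matching lets the sum of squared
positive parts of a table row grow by at most `|A_i| M²` per iteration, surely and not just in
expectation; hence the table entries are `O(√T)` from above (`of_mem_support_escher`). The expected
estimates minus the sampled ones form bounded martingale differences, so Azuma's inequality and a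
union bound over all `(i, s, a)` control the error. Alternating updates need no separate argument:
the row of `i`, hence `π_i`, is unchanged until the turn of `i` (`lexpectation_iteration_le`).

For the equilibrium claim, perfect recall makes the average policy equivalent to the uniform mixture
of the iterates (`gameValue_averagePolicy`), and in a zero-sum game the two regret bounds add up. -/

set_option linter.unusedSectionVars false

/-! ### Expectations under discrete distributions; Markov's inequality and Hoeffding's lemma. -/

section PMFExpectation

variable {α β : Type*}

/-- The expectation of an extended nonnegative function under a discrete distribution. -/
noncomputable def lexpectation (μ : PMF α) (f : α → ℝ≥0∞) : ℝ≥0∞ := ∑' z, μ z * f z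

theorem lexpectation_bind (μ : PMF α) (ν : α → PMF β) (f : β → ℝ≥0∞) :
    lexpectation (μ.bind ν) f = lexpectation μ fun a => lexpectation (ν a) f := by
  simp only [lexpectation, PMF.bind_apply, ← ENNReal.tsum_mul_right, ← ENNReal.tsum_mul_left,
    mul_assoc]
  exact ENNReal.tsum_comm

theorem lexpectation_pure (a : α) (f : α → ℝ≥0∞) : lexpectation (PMF.pure a) f = f a := by
  classical
  rw [lexpectation, tsum_eq_single a]
  · simp
  · intro b hb
    simp [PMF.pure_apply, hb]

theorem lexpectation_map (μ : PMF α) (g : α → β) (f : β → ℝ≥0∞) :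
    lexpectation (μ.map g) f = lexpectation μ fun a => f (g a) := by
  rw [← PMF.bind_pure_comp, lexpectation_bind]
  simp [lexpectation_pure]

theorem lexpectation_mono {μ : PMF α} {f g : α → ℝ≥0∞} (h : ∀ a ∈ μ.support, f a ≤ g a) :
    lexpectation μ f ≤ lexpectation μ g := by
  refine ENNReal.tsum_le_tsum fun a => ?_
  by_cases ha : μ a = 0
  · simp [ha]
  · gcongr
    exact h a ha

theorem lexpectation_const (μ : PMF α) (c : ℝ≥0∞) : lexpectation μ (fun _ => c) = c := by
  rw [lexpectation, ENNReal.tsum_mul_right, μ.tsum_coe, one_mul]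

theorem lexpectation_le_of_le {μ : PMF α} {f : α → ℝ≥0∞} {c : ℝ≥0∞}
    (h : ∀ a ∈ μ.support, f a ≤ c) : lexpectation μ f ≤ c :=
  (lexpectation_mono h).trans (lexpectation_const μ c).le

theorem lexpectation_const_mul (μ : PMF α) (c : ℝ≥0∞) (f : α → ℝ≥0∞) :
    lexpectation μ (fun a => c * f a) = c * lexpectation μ f := by
  simp only [lexpectation, ← ENNReal.tsum_mul_left]
  exact tsum_congr fun a => by ring

theorem eq_zero_of_lexpectation_le_zero {μ : PMF α} {f : α → ℝ≥0∞} (h : lexpectation μ f ≤ 0)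
    {a : α} (ha : a ∈ μ.support) : f a = 0 := by
  have h0 := ENNReal.tsum_eq_zero.1 (le_antisymm h zero_le) a
  exact (mul_eq_zero.1 h0).resolve_left ha

/-- Markov's inequality. With outer measures of a `PMF`, no measurability of events has to be
discussed. -/
theorem mul_toOuterMeasure_le_lexpectation (μ : PMF α) (f : α → ℝ≥0∞) (c : ℝ≥0∞) :
    c * μ.toOuterMeasure {a | c ≤ f a} ≤ lexpectation μ f := by
  rw [PMF.toOuterMeasure_apply, ← ENNReal.tsum_mul_left]
  refine ENNReal.tsum_le_tsum fun a => ?_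
  by_cases ha : c ≤ f a
  · rw [Set.indicator_of_mem (by exact ha), mul_comm]
    gcongr
  · rw [Set.indicator_of_notMem (by exact ha)]
    simp

theorem ofReal_one_sub_le_toOuterMeasure {μ : PMF α} {s : Set α} {p : ℝ} (hp : 0 ≤ p)
    (h : μ.toOuterMeasure sᶜ ≤ ENNReal.ofReal p) :
    ENNReal.ofReal (1 - p) ≤ μ.toOuterMeasure s := by
  have h1 : (1 : ℝ≥0∞) ≤ μ.toOuterMeasure s + μ.toOuterMeasure sᶜ := by
    have h2 := MeasureTheory.measure_union_le (μ := μ.toOuterMeasure) s sᶜ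
    rw [Set.union_compl_self, (μ.toOuterMeasure_apply_eq_one_iff Set.univ).2 (Set.subset_univ _)]
      at h2
    exact h2
  rw [ENNReal.ofReal_sub _ hp, ENNReal.ofReal_one, tsub_le_iff_right]
  exact h1.trans (by gcongr)

theorem expectation_eq_sum {μ : PMF α} {s : Finset α} (h : μ.support ⊆ s) (f : α → ℝ) :
    expectation μ f = ∑ a ∈ s, (μ a).toReal * f a := by
  refine tsum_eq_sum fun a ha => ?_
  have : μ a = 0 := by
    by_contra h0
    exact ha (h h0)
  simp [this]

theorem expectation_fintype [Fintype α] (μ : PMF α) (f : α → ℝ) :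
    expectation μ f = ∑ a, (μ a).toReal * f a :=
  expectation_eq_sum (by simp) f

theorem expectation_pure (a : α) (f : α → ℝ) : expectation (PMF.pure a) f = f a := by
  classical
  rw [expectation_eq_sum (s := {a}) (by simp)]
  simp

theorem expectation_bind {μ : PMF α} (hμ : μ.support.Finite) {ν : α → PMF β}
    (hν : ∀ a, (ν a).support.Finite) (f : β → ℝ) :
    expectation (μ.bind ν) f = expectation μ fun a => expectation (ν a) f := by
  classical
  set S := hμ.toFinset with hS
  have hSs : μ.support ⊆ S := by simp [hS]
  set T : Finset β := S.biUnion fun a => (hν a).toFinset with hT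
  have hTs : (μ.bind ν).support ⊆ T := by
    intro b hb
    obtain ⟨a, ha, hab⟩ := (PMF.mem_support_bind_iff _ _ _).1 hb
    simp only [hT, Finset.coe_biUnion, Set.mem_iUnion]
    exact ⟨a, hSs ha, by simpa using hab⟩
  rw [expectation_eq_sum hTs, expectation_eq_sum hSs]
  have hb : ∀ b, ((μ.bind ν) b).toReal = ∑ a ∈ S, (μ a).toReal * (ν a b).toReal := by
    intro b
    rw [PMF.bind_apply, tsum_eq_sum (s := S), ENNReal.toReal_sum]
    · simp
    · exact fun a _ => ENNReal.mul_ne_top (μ.apply_ne_top a) ((ν a).apply_ne_top b)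
    · intro a ha
      have : μ a = 0 := by
        by_contra h0
        exact ha (hSs h0)
      simp [this]
  simp only [hb, Finset.sum_mul]
  rw [Finset.sum_comm]
  refine Finset.sum_congr rfl fun a ha => ?_
  have hνT : (ν a).support ⊆ T := by
    intro b hb
    simp only [hT, Finset.coe_biUnion, Set.mem_iUnion]
    exact ⟨a, ha, by simpa using hb⟩
  rw [expectation_eq_sum hνT, Finset.mul_sum]
  exact Finset.sum_congr rfl fun b _ => by ring

theorem expectation_congr {μ : PMF α} {f g : α → ℝ} (h : ∀ a ∈ μ.support, f a = g a) :
    expectation μ f = expectation μ g := by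
  refine tsum_congr fun a => ?_
  by_cases ha : μ a = 0
  · simp [ha]
  · rw [h a ha]

theorem expectation_const (μ : PMF α) (c : ℝ) : expectation μ (fun _ => c) = c := by
  rw [expectation, tsum_mul_right, ← ENNReal.tsum_toReal_eq fun a => μ.apply_ne_top a, μ.tsum_coe,
    ENNReal.toReal_one, one_mul]

theorem expectation_const_mul (μ : PMF α) (c : ℝ) (f : α → ℝ) :
    expectation μ (fun a => c * f a) = c * expectation μ f := by
  simp only [expectation, ← tsum_mul_left]
  exact tsum_congr fun a => by ring

theorem expectation_add {μ : PMF α} (hμ : μ.support.Finite) (f g : α → ℝ) :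
    expectation μ (fun a => f a + g a) = expectation μ f + expectation μ g := by
  have h : μ.support ⊆ hμ.toFinset := by simp
  simp only [expectation_eq_sum h, mul_add, Finset.sum_add_distrib]

theorem expectation_sub {μ : PMF α} (hμ : μ.support.Finite) (f g : α → ℝ) :
    expectation μ (fun a => f a - g a) = expectation μ f - expectation μ g := by
  have h : μ.support ⊆ hμ.toFinset := by simp
  simp only [expectation_eq_sum h, mul_sub, Finset.sum_sub_distrib]

theorem expectation_finset_sum {μ : PMF α} (hμ : μ.support.Finite) {ι : Type*} (s : Finset ι)
    (f : ι → α → ℝ) :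
    expectation μ (fun a => ∑ j ∈ s, f j a) = ∑ j ∈ s, expectation μ (f j) := by
  have h : μ.support ⊆ hμ.toFinset := by simp
  simp only [expectation_eq_sum h, Finset.mul_sum]
  exact Finset.sum_comm

theorem expectation_mono {μ : PMF α} (hμ : μ.support.Finite) {f g : α → ℝ}
    (h : ∀ a ∈ μ.support, f a ≤ g a) : expectation μ f ≤ expectation μ g := by
  have hs : μ.support ⊆ hμ.toFinset := by simp
  simp only [expectation_eq_sum hs]
  refine Finset.sum_le_sum fun a ha => ?_
  exact mul_le_mul_of_nonneg_left (h a (by simpa using ha)) ENNReal.toReal_nonneg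

theorem abs_expectation_le {μ : PMF α} (hμ : μ.support.Finite) {f : α → ℝ} {c : ℝ}
    (h : ∀ a ∈ μ.support, |f a| ≤ c) : |expectation μ f| ≤ c := by
  rw [abs_le]
  constructor
  · rw [← expectation_const μ (-c)]
    exact expectation_mono hμ fun a ha => (abs_le.1 (h a ha)).1
  · rw [← expectation_const μ c]
    exact expectation_mono hμ fun a ha => (abs_le.1 (h a ha)).2

theorem lexpectation_ofReal {μ : PMF α} (hμ : μ.support.Finite) {f : α → ℝ}
    (hf : ∀ a ∈ μ.support, 0 ≤ f a) :
    lexpectation μ (fun a => ENNReal.ofReal (f a)) = ENNReal.ofReal (expectation μ f) := by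
  have hs : μ.support ⊆ hμ.toFinset := by simp
  rw [expectation_eq_sum hs, ENNReal.ofReal_sum_of_nonneg, lexpectation, tsum_eq_sum
    (s := hμ.toFinset)]
  · refine Finset.sum_congr rfl fun a _ => ?_
    rw [ENNReal.ofReal_mul ENNReal.toReal_nonneg, ENNReal.ofReal_toReal (μ.apply_ne_top a)]
  · intro a ha
    have : μ a = 0 := by simpa [PMF.mem_support_iff] using ha
    simp [this]
  · intro a ha
    exact mul_nonneg ENNReal.toReal_nonneg (hf a (by simpa using ha))

/-- The chord of the convex exponential over `[-cM, cM]` lies above its graph; `c * y` is the convex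
combination of the endpoints with weights `(M ± y) / (2M)`. -/
theorem exp_mul_le_cosh_add {c M y : ℝ} (hM : 0 < M) (hy : |y| ≤ M) :
    Real.exp (c * y) ≤ Real.cosh (c * M) + Real.sinh (c * M) / M * y := by
  obtain ⟨h1, h2⟩ := abs_le.1 hy
  have hc := convexOn_exp.2
  have h := @hc (c * M) (Set.mem_univ _) (-(c * M)) (Set.mem_univ _)
    ((M + y) / (2 * M)) ((M - y) / (2 * M))
    (div_nonneg (by linarith) (by linarith)) (div_nonneg (by linarith) (by linarith))
    (by field_simp; ring)
  have e : ((M + y) / (2 * M)) • (c * M) + ((M - y) / (2 * M)) • (-(c * M)) = c * y := by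
    simp only [smul_eq_mul]
    field_simp
    ring
  rw [e] at h
  refine h.trans (le_of_eq ?_)
  rw [Real.cosh_eq, Real.sinh_eq]
  simp only [smul_eq_mul]
  field_simp
  ring

/-- **Hoeffding's lemma** for a centred bounded function under a discrete distribution. -/
theorem lexpectation_exp_le {μ : PMF α} (hμ : μ.support.Finite) {Y : α → ℝ} {M : ℝ} (hM : 0 < M)
    (hY : ∀ a ∈ μ.support, |Y a| ≤ M) (h0 : expectation μ Y = 0) (c : ℝ) :
    lexpectation μ (fun a => ENNReal.ofReal (Real.exp (c * Y a))) ≤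
      ENNReal.ofReal (Real.exp ((c * M) ^ 2 / 2)) := by
  rw [lexpectation_ofReal hμ fun a _ => (Real.exp_pos _).le]
  refine ENNReal.ofReal_le_ofReal ?_
  calc expectation μ (fun a => Real.exp (c * Y a))
      ≤ expectation μ (fun a => Real.cosh (c * M) + Real.sinh (c * M) / M * Y a) :=
        expectation_mono hμ fun a ha => exp_mul_le_cosh_add hM (hY a ha)
    _ = Real.cosh (c * M) := by
        rw [expectation_add hμ, expectation_const, expectation_const_mul, h0]
        ring
    _ ≤ _ := Real.cosh_le_exp_half_sq _

end PMFExpectation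

/-! ### Normalized weights and independent draws. -/

section NormalizeOr

variable {α : Type*}

theorem normalizeOr_apply_of_ne {f : α → ℝ≥0∞} {d : PMF α} (h0 : ∑' a, f a ≠ 0)
    (h1 : ∑' a, f a ≠ ∞) (a : α) : normalizeOr f d a = f a * (∑' b, f b)⁻¹ := by
  rw [normalizeOr, dif_pos ⟨h0, h1⟩, PMF.normalize_apply]

theorem mem_of_normalizeOr_ne_zero {f : α → ℝ≥0∞} {d : PMF α} {s : Set α}
    (hf : ∀ a, f a ≠ 0 → a ∈ s) (hd : ∀ a, d a ≠ 0 → a ∈ s) {a : α}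
    (ha : normalizeOr f d a ≠ 0) : a ∈ s := by
  rw [normalizeOr] at ha
  split_ifs at ha with h
  · rw [PMF.normalize_apply] at ha
    exact hf a (left_ne_zero_of_mul ha)
  · exact hd a ha

end NormalizeOr

section IndependentDraws

variable {N : ℕ} {A : Fin N → Type v} [∀ i, Fintype (A i)]

theorem independentDraws_apply (μ : (i : Fin N) → PMF (A i)) (a : (i : Fin N) → A i) :
    independentDraws μ a = ∏ i, μ i (a i) := by
  rw [independentDraws, PMF.ofFintype_apply]

theorem independentDraws_eq_bind (μ : (i : Fin N) → PMF (A i)) (i : Fin N) :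
    independentDraws μ =
      (μ i).bind fun c => independentDraws (Function.update μ i (PMF.pure c)) := by
  ext a
  rw [PMF.bind_apply, tsum_eq_single (a i)]
  · rw [independentDraws_apply, independentDraws_apply,
      ← Finset.mul_prod_erase _ _ (Finset.mem_univ i),
      ← Finset.mul_prod_erase _ _ (Finset.mem_univ i)]
    simp only [Function.update_self, PMF.pure_apply, if_true, one_mul]
    congr 1
    refine Finset.prod_congr rfl fun j hj => ?_
    rw [Function.update_of_ne (Finset.ne_of_mem_erase hj)]
  · intro c hc
    rw [independentDraws_apply, Finset.prod_eq_zero (Finset.mem_univ i), mul_zero]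
    simp [PMF.pure_apply, hc.symm]

end IndependentDraws

/-! ### Histories, play and the one-step recursion for history values. -/

namespace GameForm

variable {N : ℕ} {W : Type u} {A : Fin N → Type v} {O : Fin N → Type x}
variable (G : GameForm N W A O)

/-- A profile of strategies of the game. -/
def IsLegal (π : G.Profile) : Prop := ∀ i, G.IsStrategy i (π i)

variable {G}

theorem IsLegal.update {π : G.Profile} (hπ : G.IsLegal π) {i : Fin N} {σ : G.Strategy i}
    (hσ : G.IsStrategy i σ) : G.IsLegal (Function.update π i σ) := by
  intro j
  by_cases h : j = i
  · subst h
    simpa using hσ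
  · simpa [Function.update_of_ne h] using hπ j

@[simp] theorem info_length (i : Fin N) (h : G.Hist) : (G.info i h).length = h.length := by
  induction h with
  | nil => rfl
  | cons x h ih => simp [info, ih]

theorem mem_legalAt_info (hG : G.IsGame) {i : Fin N} {h : G.Hist} (hh : G.IsHistory h)
    (ht : G.world h ∉ G.terminal) {a : A i} :
    a ∈ G.legalAt i (G.info i h) ↔ a ∈ G.legal i (G.world h) := by
  constructor
  · rintro ⟨h', hh', ht', he, ha⟩
    rwa [hG.legal_info i h h' hh hh' ht ht' he.symm]
  · exact fun ha => ⟨h, hh, ht, rfl, ha⟩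

theorem info_mem_infoSets {i : Fin N} {h : G.Hist} (hh : G.IsHistory h)
    (ht : G.world h ∉ G.terminal) : G.info i h ∈ G.infoSets i := ⟨h, hh, ht, rfl⟩

/-- A non-terminal history extends by one more legal step, and the extension still obeys the
horizon. -/
theorem length_lt_horizon (hG : G.IsGame) {h : G.Hist} (hh : G.IsHistory h)
    (ht : G.world h ∉ G.terminal) : h.length < G.horizon := by
  choose a ha using fun i => hG.legal_nonempty i h hh ht
  obtain ⟨w, hw⟩ := (G.trans (G.world h) a).support_nonempty
  exact hG.finite_horizon ((a, w) :: h) ⟨hh, ht, ha, hw⟩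

theorem IsHistory.of_suffix {h z : G.Hist} (hz : G.IsHistory z) (hs : h <:+ z) :
    G.IsHistory h := by
  induction z with
  | nil => rwa [List.suffix_nil.1 hs]
  | cons x z ih =>
    rcases List.suffix_cons_iff.1 hs with rfl | hs
    · exact hz
    · exact ih hz.1 hs

variable [∀ i, Fintype (A i)]

theorem finite_isHistory [Finite W] (hG : G.IsGame) : {h | G.IsHistory h}.Finite :=
  (List.finite_length_le _ G.horizon).subset fun h hh => hG.finite_horizon h hh

theorem finite_infoSets [Finite W] (hG : G.IsGame) (i : Fin N) : (G.infoSets i).Finite := by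
  refine ((finite_isHistory hG).image (G.info i)).subset ?_
  rintro s ⟨h, hh, -, rfl⟩
  exact ⟨h, hh, rfl⟩

theorem exists_of_mem_support_step {π : G.Profile} {h h' : G.Hist}
    (hs : h' ∈ (G.step π h).support) : ∃ a w, h' = (a, w) :: h ∧
      (∀ i, π i (G.info i h) (a i) ≠ 0) ∧ w ∈ (G.trans (G.world h) a).support := by
  obtain ⟨a, ha, hw⟩ := (PMF.mem_support_bind_iff _ _ _).1 hs
  obtain ⟨w, hw', rfl⟩ := (PMF.mem_support_map_iff _ _ _).1 hw
  refine ⟨a, w, rfl, fun i => ?_, hw'⟩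
  rw [PMF.mem_support_iff, independentDraws_apply] at ha
  exact fun h0 => ha (Finset.prod_eq_zero (Finset.mem_univ i) h0)

theorem isHistory_of_mem_support_step (hG : G.IsGame) {π : G.Profile} (hπ : G.IsLegal π)
    {h h' : G.Hist} (hh : G.IsHistory h) (ht : G.world h ∉ G.terminal)
    (hs : h' ∈ (G.step π h).support) : G.IsHistory h' := by
  obtain ⟨a, w, rfl, ha, hw⟩ := exists_of_mem_support_step hs
  exact ⟨hh, ht, fun i => (mem_legalAt_info hG hh ht).1
    (hπ i _ (info_mem_infoSets hh ht) _ (ha i)), hw⟩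

theorem finite_support_bind {α β : Type*} {μ : PMF α} (hμ : μ.support.Finite) {ν : α → PMF β}
    (hν : ∀ a, (ν a).support.Finite) : (μ.bind ν).support.Finite := by
  rw [PMF.support_bind]
  exact hμ.biUnion fun a _ => hν a

theorem finite_support_step [Finite W] (π : G.Profile) (h : G.Hist) :
    (G.step π h).support.Finite := by
  refine finite_support_bind (Set.toFinite _) fun a => ?_
  rw [PMF.support_map]
  exact (Set.toFinite _).image _

theorem finite_support_playFor [Finite W] (π : G.Profile) (n : ℕ) (h : G.Hist) :
    (G.playFor π n h).support.Finite := by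
  induction n generalizing h with
  | zero => simp [playFor]
  | succ n ih =>
    rw [playFor]
    split_ifs
    · simp
    · exact finite_support_bind (finite_support_step π h) ih

theorem finite_support_play [Finite W] (π : G.Profile) (h : G.Hist) :
    (G.play π h).support.Finite := finite_support_playFor π _ h

theorem length_le_of_mem_support_playFor {π : G.Profile} {n : ℕ} {h z : G.Hist}
    (hz : z ∈ (G.playFor π n h).support) : z.length ≤ h.length + n := by
  induction n generalizing h with
  | zero =>
    have : z = h := by simpa [playFor] using hz
    simp [this]
  | succ n ih =>
    rw [playFor] at hz
    split_ifs at hz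
    · have : z = h := by simpa using hz
      simp [this]
    · obtain ⟨h', hh', hz⟩ := (PMF.mem_support_bind_iff _ _ _).1 hz
      obtain ⟨a, w, rfl, -⟩ := exists_of_mem_support_step hh'
      have := ih hz
      simp only [List.length_cons] at this
      omega

theorem isHistory_of_mem_support_playFor (hG : G.IsGame) {π : G.Profile} (hπ : G.IsLegal π)
    {n : ℕ} {h z : G.Hist} (hh : G.IsHistory h) (hz : z ∈ (G.playFor π n h).support) :
    G.IsHistory z := by
  induction n generalizing h with
  | zero =>
    have : z = h := by simpa [playFor] using hz
    rwa [this]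
  | succ n ih =>
    rw [playFor] at hz
    split_ifs at hz with ht
    · have : z = h := by simpa using hz
      rwa [this]
    · obtain ⟨h', hh', hz⟩ := (PMF.mem_support_bind_iff _ _ _).1 hz
      exact ih (isHistory_of_mem_support_step hG hπ hh ht hh') hz

theorem bind_congr_of_support {α β : Type*} {μ : PMF α} {f g : α → PMF β}
    (h : ∀ a ∈ μ.support, f a = g a) : μ.bind f = μ.bind g := by
  ext b
  rw [PMF.bind_apply, PMF.bind_apply]
  refine tsum_congr fun a => ?_
  by_cases ha : μ a = 0
  · simp [ha]
  · rw [h a ha]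

theorem playFor_terminal (π : G.Profile) (n : ℕ) {h : G.Hist} (ht : G.world h ∈ G.terminal) :
    G.playFor π n h = PMF.pure h := by
  cases n with
  | zero => rfl
  | succ n => rw [playFor, if_pos ht]

theorem play_terminal (π : G.Profile) {h : G.Hist} (ht : G.world h ∈ G.terminal) :
    G.play π h = PMF.pure h := playFor_terminal π _ ht

/-- Once the allowed rounds reach the horizon, play has already ended, so one more round changes
nothing. This is needed because `play` grants the full horizon afresh at every history, which would
otherwise break the recursion `play_eq_bind`. -/
theorem playFor_succ_eq (hG : G.IsGame) {π : G.Profile} (hπ : G.IsLegal π) {n : ℕ} {h : G.Hist}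
    (hh : G.IsHistory h) (hn : G.horizon ≤ n + h.length) :
    G.playFor π (n + 1) h = G.playFor π n h := by
  induction n generalizing h with
  | zero =>
    have ht : G.world h ∈ G.terminal := by
      by_contra ht
      have := length_lt_horizon hG hh ht
      omega
    rw [playFor_terminal _ _ ht, playFor_terminal _ _ ht]
  | succ n ih =>
    by_cases ht : G.world h ∈ G.terminal
    · rw [playFor_terminal _ _ ht, playFor_terminal _ _ ht]
    · rw [playFor, if_neg ht, playFor, if_neg ht]
      refine bind_congr_of_support fun h' hs => ih (isHistory_of_mem_support_step hG hπ hh ht hs) ?_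
      obtain ⟨a, w, rfl, -⟩ := exists_of_mem_support_step hs
      simp only [List.length_cons]
      omega

theorem play_eq_bind (hG : G.IsGame) {π : G.Profile} (hπ : G.IsLegal π) {h : G.Hist}
    (hh : G.IsHistory h) (ht : G.world h ∉ G.terminal) :
    G.play π h = (G.step π h).bind (G.play π) := by
  rw [play, ← playFor_succ_eq hG hπ hh (by omega), playFor, if_neg ht]
  rfl

/-- Play from `h` consults strategies only at information states at least as long as `h`, since
these record one entry per round. Hence an override at the current information state is forgotten
after one step. -/
theorem playFor_congr {π π' : G.Profile} {n : ℕ} {h : G.Hist}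
    (H : ∀ (i : Fin N) (s : G.Info i), h.length ≤ s.length → π i s = π' i s) :
    G.playFor π n h = G.playFor π' n h := by
  induction n generalizing h with
  | zero => rfl
  | succ n ih =>
    rw [playFor, playFor]
    have hstep : G.step π h = G.step π' h := by
      simp only [step, fun i => H i (G.info i h) (by simp)]
    rw [hstep]
    congr 1
    refine bind_congr_of_support fun h' hs => ih fun i s hi => H i s ?_
    obtain ⟨a, w, rfl, -⟩ := exists_of_mem_support_step hs
    simp only [List.length_cons] at hi
    omega

theorem value_congr {π π' : G.Profile} {h : G.Hist} (k : Fin N)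
    (H : ∀ (i : Fin N) (s : G.Info i), h.length ≤ s.length → π i s = π' i s) :
    G.value k π h = G.value k π' h := by
  rw [value, value, play, play, playFor_congr H]

theorem value_terminal (k : Fin N) (π : G.Profile) {h : G.Hist}
    (ht : G.world h ∈ G.terminal) : G.value k π h = G.totalUtil k h := by
  rw [value, play_terminal π ht, expectation_pure]

theorem value_eq_expectation_step [Finite W] (hG : G.IsGame) (k : Fin N) {π : G.Profile}
    (hπ : G.IsLegal π) {h : G.Hist} (hh : G.IsHistory h) (ht : G.world h ∉ G.terminal) :
    G.value k π h = expectation (G.step π h) (G.value k π) := by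
  rw [value, play_eq_bind hG hπ hh ht,
    expectation_bind (finite_support_step π h) (finite_support_play π)]
  rfl

/-- A round of play in which player `i` deviates to `σ` can be generated by first drawing the
action of player `i`. -/
theorem step_update_eq_bind (π : G.Profile) (i : Fin N) (σ : G.Strategy i) (h : G.Hist) :
    G.step (Function.update π i σ) h =
      (σ (G.info i h)).bind fun c => G.step (G.playAt π i (G.info i h) c) h := by
  simp only [step]
  rw [independentDraws_eq_bind _ i, PMF.bind_bind]
  simp only [Function.update_self]
  congr 1
  funext c
  congr 2
  funext j
  by_cases hj : j = i
  · subst hj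
    simp [playAt]
  · simp [playAt, Function.update_of_ne hj]

theorem info_of_mem_support_step_playAt {π : G.Profile} {i : Fin N} {h h' : G.Hist} {c : A i}
    (hs : h' ∈ (G.step (G.playAt π i (G.info i h) c) h).support) :
    ∃ o, G.info i h' = (c, o) :: G.info i h := by
  obtain ⟨a, w, rfl, ha, -⟩ := exists_of_mem_support_step hs
  have hc : a i = c := by simpa [playAt] using ha i
  exact ⟨_, by rw [info, hc]⟩

theorem length_of_mem_support_step {π : G.Profile} {h h' : G.Hist}
    (hs : h' ∈ (G.step π h).support) : h'.length = h.length + 1 := by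
  obtain ⟨a, w, rfl, -⟩ := exists_of_mem_support_step hs
  rfl

theorem IsLegal.playAt {π : G.Profile} (hπ : G.IsLegal π) {i : Fin N} {s : G.Info i} {c : A i}
    (hc : c ∈ G.legalAt i s) : G.IsLegal (G.playAt π i s c) := by
  classical
  refine hπ.update fun s' hs' a ha => ?_
  by_cases h : s' = s
  · subst h
    have : a = c := by simpa using ha
    rwa [this]
  · exact hπ i s' hs' a (by simpa [Function.update_of_ne h] using ha)

theorem qValue_eq_expectation_step [Finite W] (hG : G.IsGame) {π : G.Profile}
    (hπ : G.IsLegal π) {i : Fin N} {h : G.Hist} (hh : G.IsHistory h)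
    (ht : G.world h ∉ G.terminal) {c : A i} (hc : c ∈ G.legalAt i (G.info i h)) :
    G.qValue i π h c =
      expectation (G.step (G.playAt π i (G.info i h) c) h) (G.value i π) := by
  classical
  rw [qValue, value_eq_expectation_step hG i (hπ.playAt hc) hh ht]
  refine expectation_congr fun h' hs => value_congr i fun j s hj => ?_
  rw [length_of_mem_support_step hs] at hj
  by_cases hji : j = i
  · subst hji
    -- The successor's information states are strictly longer than the overridden one.
    have : s ≠ G.info j h := by
      rintro rfl
      simp at hj
    simp [playAt, Function.update_of_ne this]
  · simp [playAt, Function.update_of_ne hji]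

/-- `historyAt` may return a terminal history when `s` is arbitrary; the estimate is then zero. -/
theorem qValue_terminal {π : G.Profile} {i : Fin N} {h : G.Hist}
    (ht : G.world h ∈ G.terminal) (c : A i) : G.qValue i π h c = G.value i π h := by
  rw [qValue, value_terminal i _ ht, value_terminal i _ ht]

/-- Averaging the history-action values with respect to the first action of a deviation `σ`. -/
theorem expectation_qValue [Finite W] (hG : G.IsGame) {π : G.Profile}
    (hπ : G.IsLegal π) {i : Fin N} {h : G.Hist} (hh : G.IsHistory h)
    (ht : G.world h ∉ G.terminal) {σ : G.Strategy i} (hσ : G.IsStrategy i σ) :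
    expectation (σ (G.info i h)) (G.qValue i π h) =
      expectation (G.step (Function.update π i σ) h) (G.value i π) := by
  rw [step_update_eq_bind, expectation_bind (Set.toFinite _) fun c => finite_support_step _ _]
  refine expectation_congr fun c hc => ?_
  exact qValue_eq_expectation_step hG hπ hh ht (hσ _ (info_mem_infoSets hh ht) _ hc)

theorem expectation_qValue_self [Finite W] (hG : G.IsGame) {π : G.Profile}
    (hπ : G.IsLegal π) {i : Fin N} {h : G.Hist} (hh : G.IsHistory h)
    (ht : G.world h ∉ G.terminal) :
    expectation (π i (G.info i h)) (G.qValue i π h) = G.value i π h := by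
  rw [expectation_qValue hG hπ hh ht (hπ i), Function.update_eq_self,
    value_eq_expectation_step hG i hπ hh ht]

/-! ### Bounds on utilities, values and regret estimates. -/

section Bounds

variable (G) in
/-- A bound on the utilities of all players. -/
def UtilBound (U : ℝ) : Prop := ∀ i w, |G.util i w| ≤ U

theorem exists_utilBound [Finite W] : ∃ U, 0 < U ∧ G.UtilBound U := by
  obtain ⟨U, hU⟩ := (Set.finite_range fun x : Fin N × W => |G.util x.1 x.2|).bddAbove
  exact ⟨max U 1, by positivity, fun i w => le_max_of_le_left (hU ⟨(i, w), rfl⟩)⟩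

theorem abs_totalUtil_le {U : ℝ} (hU : G.UtilBound U) (i : Fin N) (h : G.Hist) :
    |G.totalUtil i h| ≤ U * (h.length + 1) := by
  induction h with
  | nil => simpa [totalUtil] using hU i G.init
  | cons x h ih =>
    rw [totalUtil]
    refine (abs_add_le _ _).trans ?_
    have := hU i x.2
    push_cast [List.length_cons]
    linarith

theorem abs_value_le [Finite W] {U : ℝ} (hU0 : 0 ≤ U) (hU : G.UtilBound U) (i : Fin N)
    (π : G.Profile) (h : G.Hist) : |G.value i π h| ≤ U * (h.length + G.horizon + 1) := by
  refine abs_expectation_le (finite_support_play π h) fun z hz => ?_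
  refine (abs_totalUtil_le hU i z).trans (mul_le_mul_of_nonneg_left ?_ hU0)
  have := length_le_of_mem_support_playFor hz
  have : (z.length : ℝ) ≤ h.length + G.horizon := by exact_mod_cast this
  linarith

theorem historyAt_eq_some {i : Fin N} {z h : G.Hist} {s : G.Info i}
    (hs : G.historyAt i z s = some h) : h <:+ z ∧ G.info i h = s := by
  constructor
  · exact (List.mem_tails _ _).1 (List.mem_of_find?_eq_some hs)
  · simpa using List.find?_some hs

/-- The bound is free of `b`. A prefix of at most `horizon` rounds followed by at most `horizon`
more visits at most `2 * horizon + 1` states; the outer factor 2 comes from the difference of two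
values. -/
theorem abs_regretEstimate_le [Finite W] {U : ℝ} (hU0 : 0 ≤ U) (hU : G.UtilBound U) (i : Fin N)
    (π : G.Profile) (s : G.Info i) (a : A i) {z : G.Hist} (hz : z.length ≤ G.horizon) :
    |G.regretEstimate i π s a z| ≤ 2 * (U * (2 * G.horizon + 1)) := by
  rw [regretEstimate]
  have h0 : 0 ≤ U * (2 * G.horizon + 1) := by positivity
  split
  · next h hs =>
    have hl : (h.length : ℝ) ≤ G.horizon := by
      exact_mod_cast (historyAt_eq_some hs).1.length_le.trans hz
    have hb : ∀ π', |G.value i π' h| ≤ U * (2 * G.horizon + 1) := fun π' =>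
      (abs_value_le hU0 hU i π' h).trans (mul_le_mul_of_nonneg_left (by linarith) hU0)
    refine (abs_sub _ _).trans ?_
    have h1 := hb (G.playAt π i (G.info i h) a)
    have h2 := hb π
    rw [qValue]
    linarith
  · simpa using h0

end Bounds

end GameForm

/-! ### The gain of a deviation as a reach-weighted sum of expected regret estimates. -/

namespace GameForm

variable {N : ℕ} {W : Type u} {A : Fin N → Type v} {O : Fin N → Type x}
variable {G : GameForm N W A O} [∀ i, Fintype (A i)]

/-- The conditional expectation of the regret estimate, given the profile `π` in force. -/
noncomputable def expectedRegret (i : Fin N) (b : G.Strategy i) (π : G.Profile) (s : G.Info i)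
    (a : A i) : ℝ :=
  expectation (G.play (Function.update π i b) []) (G.regretEstimate i π s a)

/-- The quotient of the reach weights of two strategies. -/
noncomputable def reachRatio {i : Fin N} (σ b : G.Strategy i) (s : G.Info i) : ℝ :=
  (G.ownReach σ s).toReal / (G.ownReach b s).toReal

theorem reachRatio_cons {i : Fin N} (σ b : G.Strategy i) (c : A i) (o : O i) (s : G.Info i) :
    reachRatio σ b ((c, o) :: s) = (σ s c).toReal / (b s c).toReal * reachRatio σ b s := by
  simp only [reachRatio, ownReach, ENNReal.toReal_mul]
  exact mul_div_mul_comm _ _ _ _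

/-- The contribution of a history to the gain of the deviation `σ`, weighted by the quotient of
the reach weights. -/
noncomputable def weightedGain {i : Fin N} (σ b : G.Strategy i) (π : G.Profile) (h : G.Hist) : ℝ :=
  reachRatio σ b (G.info i h) *
    expectation (σ (G.info i h)) fun a => G.qValue i π h a - G.value i π h

theorem weightedGain_terminal {i : Fin N} (σ b : G.Strategy i) (π : G.Profile) {h : G.Hist}
    (ht : G.world h ∈ G.terminal) : weightedGain σ b π h = 0 := by
  simp only [weightedGain, qValue_terminal ht, sub_self, expectation_const, mul_zero]

/-- Importance weighting of one round of play. -/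
theorem expectation_step_reachRatio [Finite W] {i : Fin N} {σ b : G.Strategy i} (π : G.Profile)
    {h : G.Hist} (hb : ∀ a, σ (G.info i h) a ≠ 0 → b (G.info i h) a ≠ 0) (f : G.Hist → ℝ) :
    expectation (G.step (Function.update π i b) h)
        (fun h' => reachRatio σ b (G.info i h') * f h') =
      reachRatio σ b (G.info i h) * expectation (G.step (Function.update π i σ) h) f := by
  rw [step_update_eq_bind, step_update_eq_bind,
    expectation_bind (Set.toFinite _) fun c => finite_support_step _ _,
    expectation_bind (Set.toFinite _) fun c => finite_support_step _ _,
    expectation_fintype, expectation_fintype, Finset.mul_sum]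
  refine Finset.sum_congr rfl fun c _ => ?_
  have h1 : expectation (G.step (G.playAt π i (G.info i h) c) h)
      (fun h' => reachRatio σ b (G.info i h') * f h') =
      (σ (G.info i h) c).toReal / (b (G.info i h) c).toReal * reachRatio σ b (G.info i h) *
        expectation (G.step (G.playAt π i (G.info i h) c) h) f := by
    rw [← expectation_const_mul]
    refine expectation_congr fun h' hs => ?_
    obtain ⟨o, ho⟩ := info_of_mem_support_step_playAt hs
    rw [ho, reachRatio_cons]
  rw [h1]
  -- If `σ` avoids `c`, both terms vanish, whatever the quotient by `b`; otherwise `b` is positive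
  -- there and cancels.
  by_cases hc : σ (G.info i h) c = 0
  · simp [hc]
  · have : (b (G.info i h) c).toReal ≠ 0 :=
      ENNReal.toReal_ne_zero.2 ⟨hb c hc, PMF.apply_ne_top _ _⟩
    field_simp

/-- The gain of a deviation `σ` is the expected sum of the weighted gains along a trajectory drawn
with the sampling policy `b`. -/
theorem expectation_sum_weightedGain [Finite W] (hG : G.IsGame) {i : Fin N} {σ b : G.Strategy i}
    (hσ : G.IsStrategy i σ) (hbs : G.IsStrategy i b)
    (hb : ∀ s ∈ G.infoSets i, ∀ a, σ s a ≠ 0 → b s a ≠ 0) {π : G.Profile} (hπ : G.IsLegal π)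
    (n : ℕ) {h : G.Hist} (hh : G.IsHistory h) (hn : G.horizon ≤ n + h.length) :
    expectation (G.play (Function.update π i b) h)
        (fun z => (z.tails.map (weightedGain σ b π)).sum) =
      (h.tails.map (weightedGain σ b π)).sum - weightedGain σ b π h +
        reachRatio σ b (G.info i h) *
          (G.value i (Function.update π i σ) h - G.value i π h) := by
  induction n generalizing h with
  | zero =>
    have ht : G.world h ∈ G.terminal := by
      by_contra ht
      have := length_lt_horizon hG hh ht
      omega
    rw [play_terminal _ ht, expectation_pure, value_terminal i _ ht, value_terminal i _ ht,
      weightedGain_terminal _ _ _ ht]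
    ring
  | succ n ih =>
    by_cases ht : G.world h ∈ G.terminal
    · rw [play_terminal _ ht, expectation_pure, value_terminal i _ ht, value_terminal i _ ht,
        weightedGain_terminal _ _ _ ht]
      ring
    · have hs := info_mem_infoSets (i := i) hh ht
      rw [play_eq_bind hG (hπ.update hbs) hh ht,
        expectation_bind (finite_support_step _ _) (finite_support_play _)]
      -- The tails of `h'` are `h'` and the tails of `h`, so the subtracted gain at `h'` cancels its
      -- own entry.
      have h1 : ∀ h' ∈ (G.step (Function.update π i b) h).support,
          expectation (G.play (Function.update π i b) h')
            (fun z => (z.tails.map (weightedGain σ b π)).sum) =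
          (h.tails.map (weightedGain σ b π)).sum + reachRatio σ b (G.info i h') *
            (G.value i (Function.update π i σ) h' - G.value i π h') := by
        intro h' hs'
        rw [ih (isHistory_of_mem_support_step hG (hπ.update hbs) hh ht hs') (by
          rw [length_of_mem_support_step hs']; omega)]
        obtain ⟨a, w, rfl, -⟩ := exists_of_mem_support_step hs'
        rw [List.tails_cons, List.map_cons, List.sum_cons]
        ring
      -- Importance weighting turns the `b`-step into a `σ`-step. The average of `v_i(π, h')`
      -- becomes the `σ`-average of `q_i`, which is exactly what the gain at `h` compensates.
      rw [expectation_congr h1, expectation_add (finite_support_step _ _), expectation_const,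
        expectation_step_reachRatio π (hb _ hs), expectation_sub (finite_support_step _ _),
        ← expectation_qValue hG hπ hh ht hσ,
        ← value_eq_expectation_step hG i (hπ.update hσ) hh ht, weightedGain,
        expectation_sub (Set.toFinite _), expectation_const]
      ring

theorem historyAt_cons (i : Fin N) (y : ((i : Fin N) → A i) × W) (z : G.Hist) (s : G.Info i)
    [Decidable (G.info i (y :: z : G.Hist) = s)] :
    G.historyAt i (y :: z) s =
      if G.info i (y :: z : G.Hist) = s then some (y :: z) else G.historyAt i z s := by
  rw [historyAt, List.tails_cons, List.find?_cons]
  by_cases h : G.info i (y :: z : G.Hist) = s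
  · simp [h]
  · simp [h, historyAt]

theorem historyAt_nil (i : Fin N) (s : G.Info i) [Decidable (([] : G.Info i) = s)] :
    G.historyAt i [] s = if ([] : G.Info i) = s then some [] else none := by
  by_cases h : ([] : G.Info i) = s
  · simp [h, historyAt, info]
  · simp [h, historyAt, info]

theorem historyAt_eq_none {i : Fin N} {z : G.Hist} {s : G.Info i} (hs : z.length < s.length) :
    G.historyAt i z s = none := by
  cases h : G.historyAt i z s with
  | none => rfl
  | some h' =>
    obtain ⟨h1, rfl⟩ := historyAt_eq_some h
    have := h1.length_le
    simp at hs
    omega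

/-- A sum over the histories along `z` as a sum over information sets. -/
theorem sum_historyAt {i : Fin N} (S : Finset (G.Info i)) (f : G.Hist → ℝ) {z : G.Hist}
    (hf : ∀ h, h <:+ z → G.info i h ∉ S → f h = 0) :
    ∑ s ∈ S, ((G.historyAt i z s).elim 0 f) = (z.tails.map f).sum := by
  classical
  induction z with
  | nil =>
    simp only [historyAt_nil, List.tails, List.map_cons, List.map_nil, List.sum_cons,
      List.sum_nil, add_zero]
    have : ∀ s : G.Info i, (if ([] : G.Info i) = s then some ([] : G.Hist) else none).elim 0 f =
        if ([] : G.Info i) = s then f [] else 0 := by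
      intro s
      split_ifs <;> rfl
    simp only [this, Finset.sum_ite_eq]
    split_ifs with h
    · rfl
    · exact (hf [] List.suffix_rfl h).symm
  | cons y z ih =>
    rw [List.tails_cons, List.map_cons, List.sum_cons,
      ← ih fun h hs => hf h (hs.trans (List.suffix_cons _ _))]
    have : ∀ s : G.Info i, (G.historyAt i (y :: z) s).elim 0 f =
        (if G.info i (y :: z : G.Hist) = s then f (y :: z) else 0) +
          (G.historyAt i z s).elim 0 f := by
      intro s
      rw [historyAt_cons]
      split_ifs with h
      · subst h
        -- Information states have the length of their history, so `s` cannot also occur at a proper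
        -- prefix and is not counted twice.
        rw [historyAt_eq_none (by simp)]
        simp
      · simp
    simp only [this, Finset.sum_add_distrib, Finset.sum_ite_eq]
    congr 1
    split_ifs with h
    · rfl
    · exact (hf _ List.suffix_rfl h).symm

/-- The gain of a deviation `σ` in terms of the expected regret estimates at the information
sets. -/
theorem gameValue_update_sub [Finite W] (hG : G.IsGame) {i : Fin N} {σ b : G.Strategy i}
    (hσ : G.IsStrategy i σ) (hbs : G.IsStrategy i b)
    (hb : ∀ s ∈ G.infoSets i, ∀ a, σ s a ≠ 0 → b s a ≠ 0) {π : G.Profile} (hπ : G.IsLegal π) :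
    G.gameValue i (Function.update π i σ) - G.gameValue i π =
      ∑ s ∈ (finite_infoSets hG i).toFinset, reachRatio σ b s *
        expectation (σ s) (expectedRegret i b π s) := by
  have hnil : G.IsHistory [] := trivial
  -- At the root the reach ratio is 1 and the list of prefixes is a singleton, so only the gain of
  -- `σ` survives.
  have h1 := expectation_sum_weightedGain hG hσ hbs hb hπ G.horizon hnil (by simp)
  have hr : reachRatio σ b (G.info i []) = 1 := by simp [reachRatio, info, ownReach]
  rw [hr] at h1
  simp only [List.tails, List.map_cons, List.map_nil, List.sum_cons, List.sum_nil, add_zero,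
    sub_self, zero_add, one_mul] at h1
  rw [gameValue, gameValue, ← h1]
  have hfin := finite_support_play (G := G) (Function.update π i b) []
  have h2 : ∀ z ∈ (G.play (Function.update π i b) []).support,
      (z.tails.map (weightedGain σ b π)).sum =
      ∑ s ∈ (finite_infoSets hG i).toFinset, reachRatio σ b s *
        ∑ a, (σ s a).toReal * G.regretEstimate i π s a z := by
    intro z hz
    have hzh := isHistory_of_mem_support_playFor hG (hπ.update hbs) hnil hz
    rw [← sum_historyAt (i := i) (finite_infoSets hG i).toFinset]
    · refine Finset.sum_congr rfl fun s _ => ?_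
      cases hs : G.historyAt i z s with
      | none => simp [regretEstimate, hs]
      | some h =>
        have he := (historyAt_eq_some hs).2
        simp [regretEstimate, hs, weightedGain, he, expectation_fintype]
    · intro h hsuf hS
      by_cases ht : G.world h ∈ G.terminal
      · exact weightedGain_terminal _ _ _ ht
      · exact absurd (info_mem_infoSets (i := i) (hzh.of_suffix hsuf) ht) (by simpa using hS)
  rw [expectation_congr h2, expectation_finset_sum hfin]
  refine Finset.sum_congr rfl fun s _ => ?_
  rw [expectation_const_mul, expectation_finset_sum hfin, expectation_fintype]
  congr 1
  refine Finset.sum_congr rfl fun a _ => ?_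
  rw [expectation_const_mul, expectedRegret]

end GameForm

/-! ### Regret matching and its quadratic potential. -/

namespace GameForm

variable {N : ℕ} {W : Type u} {A : Fin N → Type v} {O : Fin N → Type x}
variable {G : GameForm N W A O} [∀ i, Fintype (A i)]

/-- At a history on the sampled trajectory the regret estimates average to zero. -/
theorem expectation_regretEstimate_eq_zero [Finite W] (hG : G.IsGame) {π : G.Profile}
    (hπ : G.IsLegal π) (i : Fin N) (s : G.Info i) {z : G.Hist} (hz : G.IsHistory z) :
    expectation (π i s) (fun a => G.regretEstimate i π s a z) = 0 := by
  cases hs : G.historyAt i z s with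
  | none => simp only [regretEstimate, hs, expectation_const]
  | some h =>
    obtain ⟨hsuf, rfl⟩ := historyAt_eq_some hs
    have hh := hz.of_suffix hsuf
    simp only [regretEstimate, hs]
    by_cases ht : G.world h ∈ G.terminal
    · simp only [qValue_terminal ht, sub_self, expectation_const]
    · rw [expectation_sub (Set.toFinite _), expectation_const,
        expectation_qValue_self hG hπ hh ht, sub_self]

variable (G) in
/-- The sum of the squares of the positive parts of a row of regrets over the legal actions. -/
noncomputable def squaredPositivePart (i : Fin N) (s : G.Info i) (r : A i → ℝ) : ℝ :=
  ∑ a, (G.legalAt i s).indicator (fun a => max (r a) 0 ^ 2) a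

theorem le_sqrt_of_squaredPositivePart_le {i : Fin N} {s : G.Info i} {r : A i → ℝ} {B : ℝ}
    (h : G.squaredPositivePart i s r ≤ B) {a : A i} (ha : a ∈ G.legalAt i s) :
    r a ≤ Real.sqrt B := by
  refine (le_max_left (r a) 0).trans (Real.le_sqrt_of_sq_le (le_trans ?_ h))
  rw [← Set.indicator_of_mem (f := fun a => max (r a) 0 ^ 2) ha]
  exact Finset.single_le_sum (f := (G.legalAt i s).indicator fun a => max (r a) 0 ^ 2)
    (fun b _ => Set.indicator_nonneg (fun _ _ => sq_nonneg _) b) (Finset.mem_univ a)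

theorem max_add_zero_sq_le (x r : ℝ) :
    max (x + r) 0 ^ 2 ≤ max x 0 ^ 2 + 2 * (max x 0 * r) + r ^ 2 := by
  rcases le_total 0 x with hx | hx <;> rcases le_total 0 (x + r) with hr | hr
  · rw [max_eq_left hx, max_eq_left hr]
    nlinarith
  · rw [max_eq_left hx, max_eq_right hr]
    nlinarith [sq_nonneg (x + r)]
  · rw [max_eq_right hx, max_eq_left hr]
    nlinarith
  · rw [max_eq_right hx, max_eq_right hr]
    nlinarith [sq_nonneg r]

variable [∀ i, Nonempty (A i)]

theorem uniform_isStrategy (hG : G.IsGame) (i : Fin N) : G.IsStrategy i (G.uniform i) := by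
  intro s hs a ha
  have h0 : ∑' a, (G.legalAt i s).indicator (1 : A i → ℝ≥0∞) a ≠ 0 := by
    obtain ⟨h, hh, ht, rfl⟩ := hs
    obtain ⟨c, hc⟩ := hG.legal_nonempty i h hh ht
    intro h0
    have := ENNReal.tsum_eq_zero.1 h0 c
    rw [Set.indicator_of_mem ((mem_legalAt_info hG hh ht).2 hc)] at this
    exact one_ne_zero this
  have h1 : ∑' a, (G.legalAt i s).indicator (1 : A i → ℝ≥0∞) a ≠ ∞ := by
    rw [tsum_fintype]
    refine ENNReal.sum_ne_top.2 fun a _ => ?_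
    by_cases h : a ∈ G.legalAt i s <;> simp [h]
  rw [uniform, normalizeOr_apply_of_ne h0 h1] at ha
  exact Set.mem_of_indicator_ne_zero (left_ne_zero_of_mul ha)

theorem regretMatching_isLegal (hG : G.IsGame) (R : (i : Fin N) → G.Info i → A i → ℝ) :
    G.IsLegal (G.regretMatching R) := by
  intro i s hs a ha
  exact mem_of_normalizeOr_ne_zero (fun a ha => Set.mem_of_indicator_ne_zero ha)
    (uniform_isStrategy hG i s hs) ha

/-- The defining property of regret matching: a regret vector that vanishes on average under the
regret matching policy is orthogonal to the positive part of the cumulative regrets. -/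
theorem sum_positivePart_mul_eq_zero (R : (i : Fin N) → G.Info i → A i → ℝ) (i : Fin N)
    (s : G.Info i) {r : A i → ℝ} (h : expectation (G.regretMatching R i s) r = 0) :
    ∑ a, (G.legalAt i s).indicator (fun a => max (R i s a) 0 * r a) a = 0 := by
  set f : A i → ℝ≥0∞ := (G.legalAt i s).indicator fun a => ENNReal.ofReal (R i s a) with hf
  have hfa : ∀ a, (G.legalAt i s).indicator (fun a => max (R i s a) 0 * r a) a =
      (f a).toReal * r a := by
    intro a
    by_cases ha : a ∈ G.legalAt i s
    · simp [hf, ha, ENNReal.toReal_ofReal']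
    · simp [hf, ha]
  simp only [hfa]
  by_cases h0 : ∑' a, f a = 0
  · refine Finset.sum_eq_zero fun a _ => ?_
    rw [ENNReal.tsum_eq_zero.1 h0 a]
    simp
  · have h1 : ∑' a, f a ≠ ∞ := by
      rw [tsum_fintype]
      refine ENNReal.sum_ne_top.2 fun a _ => ?_
      by_cases h : a ∈ G.legalAt i s <;> simp [hf, h]
    have h2 : ∀ a, (G.regretMatching R i s a).toReal * r a =
        ((∑' b, f b)⁻¹).toReal * ((f a).toReal * r a) := by
      intro a
      rw [regretMatching, normalizeOr_apply_of_ne h0 h1, ENNReal.toReal_mul]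
      ring
    rw [expectation_fintype] at h
    simp only [h2, ← Finset.mul_sum] at h
    refine (mul_eq_zero.1 h).resolve_left ?_
    exact ENNReal.toReal_ne_zero.2 ⟨ENNReal.inv_ne_zero.2 h1, ENNReal.inv_ne_top.2 h0⟩

/-- Expanding the squares, the cross term is orthogonal to `r` by regret matching; only the squares
of `r`, at most `M ^ 2` per action, remain. -/
theorem squaredPositivePart_add_le (R : (i : Fin N) → G.Info i → A i → ℝ) (i : Fin N)
    (s : G.Info i) {r : A i → ℝ} (h : expectation (G.regretMatching R i s) r = 0) {M : ℝ}
    (hr : ∀ a, |r a| ≤ M) :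
    G.squaredPositivePart i s (fun a => R i s a + r a) ≤
      G.squaredPositivePart i s (R i s) + Fintype.card (A i) * M ^ 2 := by
  have h1 : ∀ a, (G.legalAt i s).indicator (fun a => max (R i s a + r a) 0 ^ 2) a ≤
      (G.legalAt i s).indicator (fun a => max (R i s a) 0 ^ 2) a +
        2 * (G.legalAt i s).indicator (fun a => max (R i s a) 0 * r a) a + M ^ 2 := by
    intro a
    have hM : r a ^ 2 ≤ M ^ 2 := sq_le_sq' (abs_le.1 (hr a)).1 (abs_le.1 (hr a)).2
    by_cases ha : a ∈ G.legalAt i s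
    · simp only [Set.indicator_of_mem ha]
      linarith [max_add_zero_sq_le (R i s a) (r a)]
    · simp only [Set.indicator_of_notMem ha]
      nlinarith [sq_nonneg M]
  refine (Finset.sum_le_sum fun a _ => h1 a).trans (le_of_eq ?_)
  rw [Finset.sum_add_distrib, Finset.sum_add_distrib, ← Finset.mul_sum,
    sum_positivePart_mul_eq_zero R i s h, squaredPositivePart]
  simp

/-! ### One iteration from the viewpoint of one player, and sure properties of the run. -/

variable (G) in
/-- The profile in force, given the tables at the start of the iteration and at present. -/
noncomputable def profileInForce (o : UpdateOrder) (R R' : (i : Fin N) → G.Info i → A i → ℝ) :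
    G.Profile :=
  match o with
  | .simultaneous => G.regretMatching R
  | .alternating => G.regretMatching R'

variable (G) in
/-- The update of player `i` within an iteration. -/
noncomputable def playerUpdate (b : G.Profile) (o : UpdateOrder)
    (R : (i : Fin N) → G.Info i → A i → ℝ) (i : Fin N)
    (y : ((i : Fin N) → G.Info i → A i → ℝ) × (Fin N → G.Profile)) :
    PMF (((i : Fin N) → G.Info i → A i → ℝ) × (Fin N → G.Profile)) :=
  (G.play (Function.update (G.profileInForce o R y.1) i (b i)) []).map fun z =>
    (Function.update y.1 i fun s a =>
      y.1 i s a + G.regretEstimate i (G.profileInForce o R y.1) s a z,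
      Function.update y.2 i (G.profileInForce o R y.1))

theorem iteration_eq_foldl (b : G.Profile) (o : UpdateOrder)
    (R : (i : Fin N) → G.Info i → A i → ℝ) :
    G.iteration b o R = (List.finRange N).foldl (fun μ i => μ.bind (G.playerUpdate b o R i))
      (PMF.pure (R, fun _ => G.regretMatching R)) := rfl

theorem lexpectation_playerUpdate (b : G.Profile) (o : UpdateOrder)
    (R : (i : Fin N) → G.Info i → A i → ℝ) (i : Fin N)
    (y : ((i : Fin N) → G.Info i → A i → ℝ) × (Fin N → G.Profile))
    (F : (G.Info i → A i → ℝ) → G.Profile → ℝ≥0∞) :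
    lexpectation (G.playerUpdate b o R i y) (fun y' => F (y'.1 i) (y'.2 i)) =
      lexpectation (G.play (Function.update (G.profileInForce o R y.1) i (b i)) []) fun z =>
        F (fun s a => y.1 i s a + G.regretEstimate i (G.profileInForce o R y.1) s a z)
          (G.profileInForce o R y.1) := by
  rw [playerUpdate, lexpectation_map]
  simp only [Function.update_self]

theorem lexpectation_playerUpdate_of_ne (b : G.Profile) (o : UpdateOrder)
    (R : (i : Fin N) → G.Info i → A i → ℝ) {i j : Fin N} (hij : i ≠ j)
    (y : ((i : Fin N) → G.Info i → A i → ℝ) × (Fin N → G.Profile))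
    (F : (G.Info i → A i → ℝ) → G.Profile → ℝ≥0∞) :
    lexpectation (G.playerUpdate b o R j y) (fun y' => F (y'.1 i) (y'.2 i)) =
      F (y.1 i) (y.2 i) := by
  rw [playerUpdate, lexpectation_map]
  simp only [Function.update_of_ne hij, lexpectation_const]

theorem lexpectation_foldl_of_notMem (b : G.Profile) (o : UpdateOrder)
    (R : (i : Fin N) → G.Info i → A i → ℝ) {i : Fin N} {l : List (Fin N)} (hi : i ∉ l)
    (μ : PMF (((i : Fin N) → G.Info i → A i → ℝ) × (Fin N → G.Profile)))
    (F : (G.Info i → A i → ℝ) → G.Profile → ℝ≥0∞) :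
    lexpectation (l.foldl (fun μ i => μ.bind (G.playerUpdate b o R i)) μ)
      (fun y => F (y.1 i) (y.2 i)) = lexpectation μ fun y => F (y.1 i) (y.2 i) := by
  induction l generalizing μ with
  | nil => rfl
  | cons j l ih =>
    rw [List.mem_cons, not_or] at hi
    rw [List.foldl_cons, ih hi.2, lexpectation_bind]
    simp only [lexpectation_playerUpdate_of_ne b o R hi.1]

/-- The profile `π` may be in force at the update of player `i` in an iteration that starts with
the table `R`. -/
structure IsAdmissible (o : UpdateOrder) (R : (i : Fin N) → G.Info i → A i → ℝ) (i : Fin N)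
    (π : G.Profile) : Prop where
  eq_self : π i = G.regretMatching R i
  eq_regretMatching : ∃ R', π = G.regretMatching R'
  eq_of_simultaneous : o = .simultaneous → π = G.regretMatching R

/-- Regret matching for `i` reads only row `i`, so other players' earlier updates leave the strategy
of `i` as it was. -/
theorem isAdmissible_profileInForce (o : UpdateOrder) {R R' : (i : Fin N) → G.Info i → A i → ℝ}
    {i : Fin N} (h : R' i = R i) : IsAdmissible o R i (G.profileInForce o R R') := by
  have h' : G.regretMatching R' i = G.regretMatching R i := by
    funext s
    simp only [regretMatching, h]
  cases o with
  | simultaneous => exact ⟨rfl, ⟨R, rfl⟩, fun _ => rfl⟩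
  | alternating => exact ⟨h', ⟨R', rfl⟩, fun h => by cases h⟩

/-- The effect of an iteration on the data of player `i`: a bound that holds for a single update
of player `i` under every admissible profile holds for the whole iteration. -/
theorem lexpectation_iteration_le (b : G.Profile) (o : UpdateOrder)
    (R : (i : Fin N) → G.Info i → A i → ℝ) (i : Fin N)
    (F : (G.Info i → A i → ℝ) → G.Profile → ℝ≥0∞) (c : ℝ≥0∞)
    (h : ∀ π, IsAdmissible o R i π →
      lexpectation (G.play (Function.update π i (b i)) [])
        (fun z => F (fun s a => R i s a + G.regretEstimate i π s a z) π) ≤ c) :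
    lexpectation (G.iteration b o R) (fun y => F (y.1 i) (y.2 i)) ≤ c := by
  -- Generalized to any remaining list of players and any intermediate distribution with row `i`
  -- untouched. Updates before the turn of `i` preserve this; those after it do not affect the data
  -- of `i`.
  have key : ∀ (l : List (Fin N)), l.Nodup → i ∈ l →
      ∀ μ : PMF (((i : Fin N) → G.Info i → A i → ℝ) × (Fin N → G.Profile)),
      (∀ y ∈ μ.support, y.1 i = R i) →
      lexpectation (l.foldl (fun μ i => μ.bind (G.playerUpdate b o R i)) μ)
        (fun y => F (y.1 i) (y.2 i)) ≤ c := by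
    intro l
    induction l with
    | nil => intro _ hi; simp at hi
    | cons j l ih =>
      intro hl hi μ hμ
      rw [List.nodup_cons] at hl
      rw [List.foldl_cons]
      by_cases hij : i = j
      · subst hij
        rw [lexpectation_foldl_of_notMem b o R hl.1, lexpectation_bind]
        refine lexpectation_le_of_le fun y hy => ?_
        rw [lexpectation_playerUpdate, hμ y hy]
        exact h _ (isAdmissible_profileInForce o (hμ y hy))
      · refine ih hl.2 ((List.mem_cons.1 hi).resolve_left hij) _ fun y' hy' => ?_
        obtain ⟨y, hy, hy'⟩ := (PMF.mem_support_bind_iff _ _ _).1 hy'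
        obtain ⟨z, -, rfl⟩ := (PMF.mem_support_map_iff _ _ _).1 hy'
        simpa [Function.update_of_ne hij] using hμ y hy
  rw [iteration_eq_foldl]
  refine key _ (List.nodup_finRange N) (List.mem_finRange i) _ fun y hy => ?_
  rw [PMF.mem_support_pure_iff] at hy
  rw [hy]

theorem exists_of_mem_support_iteration {b : G.Profile} {o : UpdateOrder}
    {R : (i : Fin N) → G.Info i → A i → ℝ} (i : Fin N)
    {y : ((i : Fin N) → G.Info i → A i → ℝ) × (Fin N → G.Profile)}
    (hy : y ∈ (G.iteration b o R).support) :
    IsAdmissible o R i (y.2 i) ∧ ∃ z ∈ (G.play (Function.update (y.2 i) i (b i)) []).support,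
      y.1 i = fun s a => R i s a + G.regretEstimate i (y.2 i) s a z := by
  classical
  -- The expectation bound is applied with `c = 0` to the indicator of failure; zero expectation
  -- means that failure never occurs on the support.
  have h := lexpectation_iteration_le b o R i (fun row π =>
    if IsAdmissible o R i π ∧ ∃ z ∈ (G.play (Function.update π i (b i)) []).support,
      row = fun s a => R i s a + G.regretEstimate i π s a z then 0 else 1) 0 (by
    intro π hπ
    refine lexpectation_le_of_le fun z hz => ?_
    rw [if_pos ⟨hπ, z, hz, rfl⟩])
  by_contra hn
  exact hn (by simpa using eq_zero_of_lexpectation_le_zero h hy)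

/-- The almost sure properties of the state of the algorithm. -/
theorem of_mem_support_escher [Finite W] (hG : G.IsGame) {b : G.Profile} (hb : G.IsLegal b)
    {o : UpdateOrder} {U : ℝ} (hU0 : 0 ≤ U) (hU : G.UtilBound U) (T : ℕ)
    {y : ((i : Fin N) → G.Info i → A i → ℝ) × List (Fin N → G.Profile)}
    (hy : y ∈ (G.escher b o T).support) :
    y.2.length = T ∧ (∀ f ∈ y.2, ∀ i, G.IsLegal (f i)) ∧
    (o = .simultaneous → ∀ f ∈ y.2, ∀ i j, f i = f j) ∧
    ∀ i s, G.squaredPositivePart i s (y.1 i s) ≤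
      T * (Fintype.card (A i) * (2 * (U * (2 * G.horizon + 1))) ^ 2) := by
  induction T generalizing y with
  | zero =>
    rw [escher, PMF.mem_support_pure_iff] at hy
    subst hy
    simp [squaredPositivePart]
  | succ T ih =>
    obtain ⟨y₀, hy₀, hy⟩ := (PMF.mem_support_bind_iff _ _ _).1 hy
    obtain ⟨y₁, hy₁, rfl⟩ := (PMF.mem_support_map_iff _ _ _).1 hy
    obtain ⟨h1, h2, h3, h4⟩ := ih hy₀
    have hlegal : ∀ i, G.IsLegal (y₁.2 i) := fun i => by
      obtain ⟨R', hR'⟩ := (exists_of_mem_support_iteration i hy₁).1.eq_regretMatching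
      rw [hR']
      exact regretMatching_isLegal hG R'
    refine ⟨by simp [h1], ?_, fun ho => ?_, fun i s => ?_⟩
    · simp only [List.mem_cons, forall_eq_or_imp]
      exact ⟨hlegal, h2⟩
    · simp only [List.mem_cons, forall_eq_or_imp]
      refine ⟨fun i j => ?_, h3 ho⟩
      rw [(exists_of_mem_support_iteration i hy₁).1.eq_of_simultaneous ho,
        (exists_of_mem_support_iteration j hy₁).1.eq_of_simultaneous ho]
    · obtain ⟨hadm, z, hz, hrow⟩ := exists_of_mem_support_iteration i hy₁
      have hnil : G.IsHistory [] := trivial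
      have hzh := isHistory_of_mem_support_playFor hG ((hlegal i).update (hb i)) hnil hz
      have he := expectation_regretEstimate_eq_zero hG (hlegal i) i s hzh
      rw [hadm.eq_self] at he
      have := squaredPositivePart_add_le y₀.1 i s he fun a =>
        abs_regretEstimate_le hU0 hU i (y₁.2 i) s a (hG.finite_horizon z hzh)
      simp only [hrow]
      push_cast
      linarith [h4 i s]

/-! ### Martingale concentration of the cumulative estimates. -/

/-- The difference of the cumulative expected regret estimates and the cumulative regret
estimates. -/
noncomputable def estimationError (b : G.Profile) (i : Fin N) (s : G.Info i) (a : A i)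
    (y : ((i : Fin N) → G.Info i → A i → ℝ) × List (Fin N → G.Profile)) : ℝ :=
  (y.2.map fun f => expectedRegret i (b i) (f i) s a).sum - y.1 i s a

/-- The profile in force is fixed before the trajectory is drawn, so each increment is conditionally
centred and Hoeffding's lemma contributes one factor per iteration. The range is `2 * M`: an
estimate and its mean are each bounded by `M`. -/
theorem lexpectation_exp_estimationError_le [Finite W] (b : G.Profile)
    (o : UpdateOrder) {U : ℝ} (hU0 : 0 < U) (hU : G.UtilBound U) (i : Fin N) (s : G.Info i)
    (a : A i) (c : ℝ) (T : ℕ) :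
    lexpectation (G.escher b o T)
        (fun y => ENNReal.ofReal (Real.exp (c * estimationError b i s a y))) ≤
      ENNReal.ofReal (Real.exp (T * ((c * (2 * (2 * (U * (2 * G.horizon + 1))))) ^ 2 / 2))) := by
  set M : ℝ := 2 * (U * (2 * G.horizon + 1)) with hM
  have hM0 : 0 < M := by positivity
  induction T with
  | zero => simp [escher, lexpectation_pure, estimationError]
  | succ T ih =>
    set B : ℝ≥0∞ := ENNReal.ofReal (Real.exp ((c * (2 * M)) ^ 2 / 2)) with hB
    have hstep : ∀ y : ((i : Fin N) → G.Info i → A i → ℝ) × List (Fin N → G.Profile),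
        lexpectation (G.iteration b o y.1) (fun y' => ENNReal.ofReal (Real.exp
          (c * estimationError b i s a (y'.1, y'.2 :: y.2)))) ≤
        B * ENNReal.ofReal (Real.exp (c * estimationError b i s a y)) := by
      intro y
      refine lexpectation_iteration_le b o y.1 i (fun row π => ENNReal.ofReal (Real.exp
        (c * (expectedRegret i (b i) π s a +
          (y.2.map fun f => expectedRegret i (b i) (f i) s a).sum - row s a)))) _ fun π _ => ?_
      have hfin := finite_support_play (G := G) (Function.update π i (b i)) []
      have hbd : ∀ z ∈ (G.play (Function.update π i (b i)) []).support,
          |G.regretEstimate i π s a z| ≤ M := fun z hz =>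
        abs_regretEstimate_le hU0.le hU i π s a
          (by simpa using length_le_of_mem_support_playFor hz)
      have hexp : |expectedRegret i (b i) π s a| ≤ M := abs_expectation_le hfin hbd
      have hoeff := lexpectation_exp_le hfin
        (Y := fun z => expectedRegret i (b i) π s a - G.regretEstimate i π s a z)
        (M := 2 * M) (by positivity)
        (fun z hz => (abs_sub _ _).trans (by linarith [hbd z hz]))
        (by rw [expectation_sub hfin, expectation_const, expectedRegret, sub_self]) c
      rw [mul_comm B]
      refine le_trans (le_of_eq ?_) (mul_le_mul_right hoeff _)
      rw [← lexpectation_const_mul]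
      congr 1
      funext z
      rw [← ENNReal.ofReal_mul (Real.exp_pos _).le, ← Real.exp_add, estimationError]
      congr 2
      ring
    calc lexpectation (G.escher b o (T + 1))
          (fun y => ENNReal.ofReal (Real.exp (c * estimationError b i s a y)))
        = lexpectation (G.escher b o T) (fun y => lexpectation (G.iteration b o y.1) (fun y' =>
            ENNReal.ofReal (Real.exp (c * estimationError b i s a (y'.1, y'.2 :: y.2))))) := by
          rw [escher, lexpectation_bind]
          simp only [lexpectation_map]
      _ ≤ lexpectation (G.escher b o T) (fun y =>
            B * ENNReal.ofReal (Real.exp (c * estimationError b i s a y))) :=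
          lexpectation_mono fun y _ => hstep y
      _ ≤ B * ENNReal.ofReal (Real.exp (T * ((c * (2 * M)) ^ 2 / 2))) := by
          rw [lexpectation_const_mul]
          gcongr
      _ = _ := by
          rw [hB, ← ENNReal.ofReal_mul (Real.exp_pos _).le, ← Real.exp_add]
          congr 2
          push_cast
          ring

/-- **Azuma's inequality** for the cumulative regret estimates. -/
theorem toOuterMeasure_estimationError_le [Finite W] (b : G.Profile)
    (o : UpdateOrder) {U : ℝ} (hU0 : 0 < U) (hU : G.UtilBound U) (i : Fin N) (s : G.Info i)
    (a : A i) {T : ℕ} (hT : 0 < T) {ε : ℝ} (hε : 0 ≤ ε) :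
    (G.escher b o T).toOuterMeasure {y | ε ≤ estimationError b i s a y} ≤
      ENNReal.ofReal (Real.exp
        (-(ε ^ 2 / (8 * (2 * (U * (2 * G.horizon + 1))) ^ 2 * T)))) := by
  have h := fun c => lexpectation_exp_estimationError_le b o hU0 hU i s a c T
  set M : ℝ := 2 * (U * (2 * G.horizon + 1)) with hM
  have hM0 : 0 < M := by positivity
  have hT0 : (0 : ℝ) < T := by exact_mod_cast hT
  -- The minimizer of the Chernoff exponent `T * (2 * c * M) ^ 2 / 2 - c * ε`.
  set c : ℝ := ε / (4 * M ^ 2 * T) with hc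
  have hc0 : 0 ≤ c := by positivity
  have h1 := (mul_toOuterMeasure_le_lexpectation (G.escher b o T) _
    (ENNReal.ofReal (Real.exp (c * ε)))).trans (h c)
  have h2 : (G.escher b o T).toOuterMeasure {y | ε ≤ estimationError b i s a y} ≤
      (G.escher b o T).toOuterMeasure {y | ENNReal.ofReal (Real.exp (c * ε)) ≤
        ENNReal.ofReal (Real.exp (c * estimationError b i s a y))} := by
    refine MeasureTheory.measure_mono fun y hy => ?_
    exact ENNReal.ofReal_le_ofReal (Real.exp_le_exp.2 (mul_le_mul_of_nonneg_left hy hc0))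
  refine h2.trans ?_
  rw [mul_comm, ← ENNReal.le_div_iff_mul_le (Or.inl (by simp [Real.exp_pos]))
      (Or.inl ENNReal.ofReal_ne_top),
    ← ENNReal.ofReal_div_of_pos (Real.exp_pos _), ← Real.exp_sub] at h1
  refine h1.trans (le_of_eq ?_)
  congr 2
  rw [hc]
  field_simp
  ring

end GameForm

/-! ### Sums over lists. -/

section ListSums

variable {α β : Type*}

theorem expectation_list_sum {μ : PMF α} (hμ : μ.support.Finite) (L : List β) (f : β → α → ℝ) :
    expectation μ (fun a => (L.map fun τ => f τ a).sum) =
      (L.map fun τ => expectation μ (f τ)).sum := by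
  induction L with
  | nil => simp [expectation_const]
  | cons τ L ih => simp only [List.map_cons, List.sum_cons, expectation_add hμ, ih]

theorem list_sum_finset_sum {M : Type*} [AddCommMonoid M] (L : List β) (s : Finset α)
    (f : β → α → M) :
    (L.map fun τ => ∑ a ∈ s, f τ a).sum = ∑ a ∈ s, (L.map fun τ => f τ a).sum := by
  induction L with
  | nil => simp
  | cons τ L ih => simp only [List.map_cons, List.sum_cons, Finset.sum_add_distrib, ih]

theorem list_sum_ne_top {L : List β} {f : β → ℝ≥0∞} (h : ∀ τ, f τ ≠ ∞) :
    (L.map f).sum ≠ ∞ := by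
  induction L with
  | nil => simp
  | cons τ L ih => simp [h, ih]

theorem toReal_list_sum {L : List β} {f : β → ℝ≥0∞} (h : ∀ τ, f τ ≠ ∞) :
    (L.map f).sum.toReal = (L.map fun τ => (f τ).toReal).sum := by
  induction L with
  | nil => simp
  | cons τ L ih =>
    simp only [List.map_cons, List.sum_cons]
    rw [ENNReal.toReal_add (h τ) (list_sum_ne_top h), ih]

theorem list_sum_sub (L : List β) (f g : β → ℝ) :
    (L.map fun τ => f τ - g τ).sum = (L.map f).sum - (L.map g).sum := by
  induction L with
  | nil => simp
  | cons τ L ih =>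
    simp only [List.map_cons, List.sum_cons, ih]
    ring

end ListSums

/-! ### The average policy and approximate equilibria. -/

namespace GameForm

variable {N : ℕ} {W : Type u} {A : Fin N → Type v} {O : Fin N → Type x}
variable {G : GameForm N W A O} [∀ i, Fintype (A i)]

theorem ownReach_ne_top {i : Fin N} (σ : G.Strategy i) (s : G.Info i) : G.ownReach σ s ≠ ∞ := by
  induction s with
  | nil => simp [ownReach]
  | cons y s ih => exact ENNReal.mul_ne_top (PMF.apply_ne_top _ _) ih

/-- The probability of the own action is absorbed into the reach weight of the successor. The step
that remains does not involve `σ`, which makes play linear in reach weights. -/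
theorem ownReach_mul_expectation_playFor_succ [Finite W] (π : G.Profile) (i : Fin N)
    (σ : G.Strategy i) (n : ℕ) {h : G.Hist} (ht : G.world h ∉ G.terminal) (f : G.Hist → ℝ) :
    (G.ownReach σ (G.info i h)).toReal *
        expectation (G.playFor (Function.update π i σ) (n + 1) h) f =
      ∑ c, expectation (G.step (G.playAt π i (G.info i h) c) h) fun h' =>
        (G.ownReach σ (G.info i h')).toReal *
          expectation (G.playFor (Function.update π i σ) n h') f := by
  rw [playFor, if_neg ht, expectation_bind (finite_support_step _ _) (finite_support_playFor _ _),
    step_update_eq_bind, expectation_bind (Set.toFinite _) fun c => finite_support_step _ _,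
    expectation_fintype, Finset.mul_sum]
  refine Finset.sum_congr rfl fun c _ => ?_
  rw [← expectation_const_mul, ← expectation_const_mul]
  refine expectation_congr fun h' hs => ?_
  obtain ⟨o, ho⟩ := info_of_mem_support_step_playAt hs
  rw [ho, ownReach, ENNReal.toReal_mul]
  ring

/-- Perfect recall: a strategy whose reach weights are the sum of those of the strategies in `L`
induces the sum of the expectations. -/
theorem expectation_playFor_of_ownReach_eq [Finite W] (π : G.Profile) (i : Fin N)
    (σ : G.Strategy i) (L : List (G.Strategy i)) (m : ℝ)
    (hL : ∀ s, m * (G.ownReach σ s).toReal = (L.map fun τ => (G.ownReach τ s).toReal).sum)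
    (f : G.Hist → ℝ) (n : ℕ) (h : G.Hist) :
    m * ((G.ownReach σ (G.info i h)).toReal *
        expectation (G.playFor (Function.update π i σ) n h) f) =
      (L.map fun τ => (G.ownReach τ (G.info i h)).toReal *
        expectation (G.playFor (Function.update π i τ) n h) f).sum := by
  have hpure : m * ((G.ownReach σ (G.info i h)).toReal * f h) =
      (L.map fun τ => (G.ownReach τ (G.info i h)).toReal * f h).sum := by
    rw [List.sum_map_mul_right, ← hL, mul_assoc]
  induction n generalizing h with
  | zero => simpa only [playFor, expectation_pure] using hpure
  | succ n ih =>
    by_cases ht : G.world h ∈ G.terminal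
    · simpa only [playFor_terminal _ _ ht, expectation_pure] using hpure
    · simp only [ownReach_mul_expectation_playFor_succ π i _ n ht f]
      rw [list_sum_finset_sum, Finset.mul_sum]
      refine Finset.sum_congr rfl fun c _ => ?_
      rw [← expectation_const_mul, ← expectation_list_sum (finite_support_step _ _)]
      refine expectation_congr fun h' _ => ih h' ?_
      rw [List.sum_map_mul_right, ← hL, mul_assoc]

theorem gameValue_of_ownReach_eq [Finite W] (π : G.Profile) (k i : Fin N)
    (σ : G.Strategy i) (L : List (G.Strategy i)) (m : ℝ)
    (hL : ∀ s, m * (G.ownReach σ s).toReal = (L.map fun τ => (G.ownReach τ s).toReal).sum) :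
    m * G.gameValue k (Function.update π i σ) =
      (L.map fun τ => G.gameValue k (Function.update π i τ)).sum := by
  have h := expectation_playFor_of_ownReach_eq π i σ L m hL (G.totalUtil k) G.horizon []
  simpa [info, ownReach, gameValue, value, play] using h

variable [∀ i, Nonempty (A i)]

/-- The numerator of the average policy at `(s, a)` is the summed reach of the extended state and
its denominator the summed reach of `s`, so the product along `s` telescopes. -/
theorem length_mul_ownReach_averagePolicy (L : List (Fin N → G.Profile)) (i : Fin N)
    (s : G.Info i) :
    (L.length : ℝ≥0∞) * G.ownReach (G.averagePolicy L i) s =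
      (L.map fun f => G.ownReach (f i i) s).sum := by
  induction s with
  | nil => simp [ownReach]
  | cons y s ih =>
    obtain ⟨a, o⟩ := y
    set g : A i → ℝ≥0∞ := fun a => (L.map fun f => G.ownReach (f i i) s * f i i s a).sum with hg
    have hsum : ∑' a, g a = (L.map fun f => G.ownReach (f i i) s).sum := by
      rw [tsum_fintype, ← list_sum_finset_sum]
      congr 2
      funext f
      rw [← Finset.mul_sum, ← tsum_fintype (L := .unconditional _), PMF.tsum_coe, mul_one]
    have hga : (L.map fun f => G.ownReach (f i i) ((a, o) :: s)).sum = g a := by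
      simp only [ownReach, hg, mul_comm]
    have htop : ∑' a, g a ≠ ∞ := by
      rw [hsum]
      exact list_sum_ne_top fun f => ownReach_ne_top _ _
    rw [hga, ownReach, mul_left_comm, ih, ← hsum]
    -- With a zero denominator both sides vanish, so the uniform default is immaterial.
    by_cases h0 : ∑' a, g a = 0
    · rw [h0, mul_zero, ENNReal.tsum_eq_zero.1 h0 a]
    · rw [averagePolicy, normalizeOr_apply_of_ne h0 htop, mul_assoc,
        ENNReal.inv_mul_cancel h0 htop, mul_one]

theorem gameValue_averagePolicy [Finite W] (L : List (Fin N → G.Profile)) (π : G.Profile)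
    (k i : Fin N) :
    L.length * G.gameValue k (Function.update π i (G.averagePolicy L i)) =
      (L.map fun f => G.gameValue k (Function.update π i (f i i))).sum := by
  have h := gameValue_of_ownReach_eq π k i (G.averagePolicy L i) (L.map fun f => f i i) L.length
    fun s => by
      rw [List.map_map]
      have := congrArg ENNReal.toReal (length_mul_ownReach_averagePolicy L i s)
      rw [ENNReal.toReal_mul, toReal_list_sum fun f => ownReach_ne_top _ _] at this
      simpa [Function.comp_def] using this
  simpa [List.map_map, Function.comp_def] using h

theorem averagePolicy_isLegal (hG : G.IsGame) {L : List (Fin N → G.Profile)}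
    (hL : ∀ f ∈ L, ∀ i, G.IsLegal (f i)) : G.IsLegal (G.averagePolicy L) := by
  intro i s hs a ha
  refine mem_of_normalizeOr_ne_zero (fun a ha => ?_) (uniform_isStrategy hG i s hs) ha
  by_contra hna
  refine ha (List.sum_eq_zero fun t ht => ?_)
  obtain ⟨f, hf, rfl⟩ := List.mem_map.1 ht
  have : f i i s a = 0 := by
    by_contra h0
    exact hna (hL f hf i i s hs a h0)
  rw [this, mul_zero]

/-- Small regrets of both players make the average policy an approximate equilibrium. -/
theorem isApproxNash_averagePolicy [Finite W] (hG : G.IsGame) (hz : G.IsTwoPlayerZeroSum)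
    {L : List (Fin N → G.Profile)} (hne : L ≠ []) (hL : ∀ f ∈ L, ∀ i, G.IsLegal (f i))
    (hconst : ∀ f ∈ L, ∀ i j, f i = f j) {B : Fin N → ℝ} (hB : ∀ i, G.RegretLE i L (B i)) :
    G.IsApproxNash ((∑ i, B i) / L.length) (G.averagePolicy L) := by
  obtain ⟨hN, hzero⟩ := hz
  have hT : (0 : ℝ) < L.length := by exact_mod_cast List.length_pos_iff.2 hne
  have havg := averagePolicy_isLegal hG hL
  set q := G.averagePolicy L with hq
  -- the total payoff of a deviation against the average of the opponent
  have hdev : ∀ i j : Fin N, i ≠ j → ∀ σ : G.Strategy i,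
      L.length * G.gameValue i (Function.update q i σ) =
        (L.map fun f => G.gameValue i (Function.update (f i) i σ)).sum := by
    intro i j hij σ
    have h := gameValue_averagePolicy L (Function.update q i σ) i j
    rw [Function.update_comm hij, ← hq, Function.update_eq_self] at h
    rw [h]
    congr 1
    refine List.map_congr_left fun f hf => ?_
    congr 1
    funext k
    -- With two players the components at `i` and `j` determine the profile; `hconst` identifies the
    -- strategies recorded at the two updates.
    have hk : k = i ∨ k = j := by
      subst hN
      fin_cases i <;> fin_cases j <;> fin_cases k <;> simp_all
    rcases hk with rfl | rfl
    · simp [Function.update_of_ne hij]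
    · simp [Function.update_of_ne hij.symm, hconst f hf i k]
  have hbound : ∀ i j : Fin N, i ≠ j → ∀ σ : G.Strategy i, G.IsStrategy i σ →
      L.length * G.gameValue i (Function.update q i σ) ≤
        (L.map fun f => G.gameValue i (f i)).sum + B i := by
    intro i j hij σ hσ
    have h := hB i σ hσ
    rw [list_sum_sub, ← hdev i j hij σ] at h
    linarith
  have hsum : ∀ i j : Fin N, i ≠ j → ∀ g : Fin N → ℝ, ∑ k, g k = g i + g j := by
    intro i j hij g
    subst hN
    rw [Fin.sum_univ_two]
    fin_cases i <;> fin_cases j <;> simp_all [add_comm]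
  intro i σ hσ
  obtain ⟨j, hij⟩ : ∃ j : Fin N, i ≠ j := by
    subst hN
    fin_cases i
    · exact ⟨1, by simp⟩
    · exact ⟨0, by simp⟩
  have h1 := hbound i j hij σ hσ
  -- Comparing the opponent with its own average strategy bounds `v_j(q)` from above, hence `v_i(q)
  -- = -v_j(q)` from below.
  have h2 := hbound j i hij.symm (q j) (havg j)
  rw [Function.update_eq_self] at h2
  have h3 := hzero q havg
  rw [hsum i j hij] at h3
  have h4 : (L.map fun f => G.gameValue i (f i)).sum +
      (L.map fun f => G.gameValue j (f j)).sum = 0 := by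
    rw [← List.sum_map_add]
    refine List.sum_eq_zero fun t ht => ?_
    obtain ⟨f, hf, rfl⟩ := List.mem_map.1 ht
    have := hzero (f i) (hL f hf i)
    rw [hsum i j hij] at this
    rw [hconst f hf j i, this]
  rw [hsum i j hij B, ← sub_le_iff_le_add', le_div_iff₀ hT]
  have h5 : G.gameValue j q = -G.gameValue i q := by linarith
  rw [h5] at h2
  linarith

end GameForm

/-! ### Assembling the high-probability regret bound. -/

namespace GameForm

variable {N : ℕ} {W : Type u} {A : Fin N → Type v} {O : Fin N → Type x}
variable {G : GameForm N W A O} [∀ i, Fintype (A i)]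

theorem IsSamplingPolicy.isLegal {b : G.Profile} (hb : G.IsSamplingPolicy b) : G.IsLegal b :=
  fun i s hs a ha => (hb i s hs a).1 ha

theorem ownReach_le_one {i : Fin N} (σ : G.Strategy i) (s : G.Info i) : G.ownReach σ s ≤ 1 := by
  induction s with
  | nil => simp [ownReach]
  | cons y s ih => exact mul_le_one' (PMF.coe_le_one _ _) ih

theorem ownReach_info_ne_zero (hG : G.IsGame) {b : G.Profile} (hb : G.IsSamplingPolicy b)
    (i : Fin N) {h : G.Hist} (hh : G.IsHistory h) : G.ownReach (b i) (G.info i h) ≠ 0 := by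
  induction h with
  | nil => simp [info, ownReach]
  | cons y h ih =>
    obtain ⟨hh, ht, ha, -⟩ := hh
    exact mul_ne_zero ((hb i _ (info_mem_infoSets hh ht) _).2
      ((mem_legalAt_info hG hh ht).2 (ha i))) (ih hh)

theorem minReach_le {b : G.Profile} {i : Fin N} {s : G.Info i} (hs : s ∈ G.infoSets i) :
    G.minReach b i ≤ (G.ownReach (b i) s).toReal :=
  ciInf_le (f := fun s : G.infoSets i => (G.ownReach (b i) s.1).toReal)
    ⟨0, by rintro _ ⟨s, rfl⟩; exact ENNReal.toReal_nonneg⟩ ⟨s, hs⟩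

theorem minReach_nonneg (b : G.Profile) (i : Fin N) : 0 ≤ G.minReach b i :=
  Real.iInf_nonneg fun _ => ENNReal.toReal_nonneg

theorem minReach_pos [Finite W] (hG : G.IsGame) {b : G.Profile} (hb : G.IsSamplingPolicy b)
    {i : Fin N} (hne : (G.infoSets i).Nonempty) : 0 < G.minReach b i := by
  have := (finite_infoSets hG i).to_subtype
  have := hne.to_subtype
  obtain ⟨⟨s, h, hh, ht, rfl⟩, hs⟩ :=
    exists_eq_ciInf_of_finite (f := fun s : G.infoSets i => (G.ownReach (b i) s.1).toReal)
  rw [minReach, ← hs]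
  exact ENNReal.toReal_pos (ownReach_info_ne_zero hG hb i hh) (ownReach_ne_top _ _)

theorem RegretLE.mono {i : Fin N} {L : List (Fin N → G.Profile)} {B B' : ℝ}
    (h : G.RegretLE i L B) (hB : B ≤ B') : G.RegretLE i L B' :=
  fun σ hσ => (h σ hσ).trans hB

/-- Bounds on the cumulative expected regret estimates bound the regret. -/
theorem regretLE_of_expectedRegret_le [Finite W] (hG : G.IsGame) {b : G.Profile}
    (hb : G.IsSamplingPolicy b) {i : Fin N} {L : List (Fin N → G.Profile)}
    (hL : ∀ f ∈ L, G.IsLegal (f i)) {K : ℝ} (hK0 : 0 ≤ K)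
    (hK : ∀ s ∈ G.infoSets i, ∀ a ∈ G.legalAt i s,
      (L.map fun f => expectedRegret i (b i) (f i) s a).sum ≤ K) :
    G.RegretLE i L ((G.infoSets i).ncard * K / G.minReach b i) := by
  intro σ hσ
  have hbs := hb.isLegal i
  have hσb : ∀ s ∈ G.infoSets i, ∀ a, σ s a ≠ 0 → b i s a ≠ 0 :=
    fun s hs a ha => (hb i s hs a).2 (hσ s hs a ha)
  have h1 : (L.map fun f => G.gameValue i (Function.update (f i) i σ) - G.gameValue i (f i)) =
      L.map fun f => ∑ s ∈ (finite_infoSets hG i).toFinset, reachRatio σ (b i) s *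
        expectation (σ s) (expectedRegret i (b i) (f i) s) :=
    List.map_congr_left fun f hf => gameValue_update_sub hG hσ hbs hσb (hL f hf)
  rw [h1, list_sum_finset_sum]
  have h2 : ∀ s ∈ (finite_infoSets hG i).toFinset,
      (L.map fun f => reachRatio σ (b i) s *
        expectation (σ s) (expectedRegret i (b i) (f i) s)).sum ≤ K / G.minReach b i := by
    intro s hs
    replace hs : s ∈ G.infoSets i := by simpa using hs
    -- Positivity is available because `s` exists; without information sets the sum is empty and the
    -- bound is 0.
    have hw := minReach_pos hG hb ⟨s, hs⟩
    rw [List.sum_map_mul_left, ← expectation_list_sum (Set.toFinite _)]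
    have hE : expectation (σ s)
        (fun a => (L.map fun f => expectedRegret i (b i) (f i) s a).sum) ≤ K := by
      rw [← expectation_const (σ s) K]
      exact expectation_mono (Set.toFinite _) fun a ha => hK s hs a (hσ s hs a ha)
    have hr0 : 0 ≤ reachRatio σ (b i) s := div_nonneg ENNReal.toReal_nonneg ENNReal.toReal_nonneg
    have hr1 : reachRatio σ (b i) s ≤ 1 / G.minReach b i := by
      refine div_le_div₀ zero_le_one ?_ hw (minReach_le hs)
      exact ENNReal.toReal_le_of_le_ofReal zero_le_one (by simpa using ownReach_le_one σ s)
    calc _ ≤ reachRatio σ (b i) s * K := mul_le_mul_of_nonneg_left hE hr0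
      _ ≤ 1 / G.minReach b i * K := mul_le_mul_of_nonneg_right hr1 hK0
      _ = _ := by ring
  refine (Finset.sum_le_sum h2).trans (le_of_eq ?_)
  rw [Finset.sum_const, nsmul_eq_mul, ← Set.ncard_eq_toFinset_card _ (finite_infoSets hG i)]
  ring

variable [∀ i, Nonempty (A i)]

/-- All cumulative expected regret estimates are close to their realizations with high
probability. -/
theorem toOuterMeasure_exists_estimationError_le [Finite W] (hG : G.IsGame) (b : G.Profile)
    (o : UpdateOrder) {U : ℝ} (hU0 : 0 < U) (hU : G.UtilBound U) {T : ℕ} (hT : 0 < T) {p : ℝ}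
    (hp0 : 0 < p) (hp1 : p < 1) :
    (G.escher b o T).toOuterMeasure (⋃ c : (i : Fin N) × (G.infoSets i × A i),
      {y | Real.sqrt (8 * (1 + Nat.card ((i : Fin N) × (G.infoSets i × A i)))) *
        (2 * (U * (2 * G.horizon + 1))) * Real.sqrt T * Real.sqrt (1 + Real.log (1 / p)) ≤
          estimationError b c.1 c.2.1 c.2.2 y}) ≤ ENNReal.ofReal p := by
  have hfin := fun i => (finite_infoSets hG i).to_subtype
  have := Fintype.ofFinite ((i : Fin N) × (G.infoSets i × A i))
  set K : ℕ := Nat.card ((i : Fin N) × (G.infoSets i × A i)) with hK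
  have hT0 : (0 : ℝ) < T := by exact_mod_cast hT
  have hM0 : 0 < 2 * (U * (2 * G.horizon + 1)) := by positivity
  have hl : 0 < Real.log (1 / p) := Real.log_pos (by rw [lt_div_iff₀ hp0]; linarith)
  refine (MeasureTheory.measure_iUnion_fintype_le _ _).trans ?_
  refine (Finset.sum_le_sum fun c _ => toOuterMeasure_estimationError_le b o hU0 hU c.1 c.2.1 c.2.2
    hT (by positivity)).trans ?_
  rw [Finset.sum_const, nsmul_eq_mul, Finset.card_univ, ← Nat.card_eq_fintype_card, ← hK,
    ← ENNReal.ofReal_natCast, ← ENNReal.ofReal_mul (Nat.cast_nonneg _)]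
  refine ENNReal.ofReal_le_ofReal ?_
  have he : (Real.sqrt (8 * (1 + K)) * (2 * (U * (2 * G.horizon + 1))) * Real.sqrt T *
      Real.sqrt (1 + Real.log (1 / p))) ^ 2 / (8 * (2 * (U * (2 * G.horizon + 1))) ^ 2 * T) =
      (1 + K) * (1 + Real.log (1 / p)) := by
    rw [mul_pow, mul_pow, mul_pow, Real.sq_sqrt (by positivity), Real.sq_sqrt (by positivity),
      Real.sq_sqrt (by positivity)]
    field_simp
  rw [he]
  -- The factor `8 * (1 + K)` under the root makes the Azuma exponent at least `K + log (1 / p)`;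
  -- then `K * exp (-K) ≤ 1` pays for the union bound.
  have hKl : (K : ℝ) + Real.log (1 / p) ≤ (1 + K) * (1 + Real.log (1 / p)) := by
    nlinarith [mul_nonneg (Nat.cast_nonneg (α := ℝ) K) hl.le]
  calc (K : ℝ) * Real.exp (-((1 + K) * (1 + Real.log (1 / p))))
      ≤ Real.exp K * Real.exp (-(K + Real.log (1 / p))) := by
        gcongr
        linarith [Real.add_one_le_exp (K : ℝ)]
    _ = p := by
        rw [← Real.exp_add, one_div, Real.log_inv]
        ring_nf
        exact Real.exp_log hp0

variable (G) in
/-- The factor in the regret bound of player `i`, given a bound `U` on the utilities. -/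
noncomputable def regretFactor (U : ℝ) (i : Fin N) : ℝ :=
  (G.infoSets i).ncard * ((Real.sqrt (Fintype.card (A i)) +
    Real.sqrt (8 * (1 + Nat.card ((i : Fin N) × (G.infoSets i × A i))))) *
      (2 * (U * (2 * G.horizon + 1))))

theorem toOuterMeasure_regretLE [Finite W] (hG : G.IsGame) {b : G.Profile}
    (hb : G.IsSamplingPolicy b) (o : UpdateOrder) {U : ℝ} (hU0 : 0 < U) (hU : G.UtilBound U)
    {C : ℝ} (hC : ∀ i, G.regretFactor U i ≤ C) (T : ℕ) {p : ℝ} (hp0 : 0 < p) (hp1 : p < 1) :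
    ENNReal.ofReal (1 - p) ≤ (G.escher b o T).toOuterMeasure
      {y | ∀ i, G.RegretLE i y.2
        (C / G.minReach b i * Real.sqrt T * Real.sqrt (1 + Real.log (1 / p)))} := by
  refine ofReal_one_sub_le_toOuterMeasure hp0.le ?_
  have hM0 : 0 < 2 * (U * (2 * G.horizon + 1)) := by positivity
  have hl : 0 < Real.log (1 / p) := Real.log_pos (by rw [lt_div_iff₀ hp0]; linarith)
  -- Azuma's bound divides by `T`; at `T = 0` the record is empty and the regret is 0.
  rcases Nat.eq_zero_or_pos T with rfl | hT
  · refine le_trans (le_of_eq ?_) zero_le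
    rw [PMF.toOuterMeasure_apply_eq_zero_iff, Set.disjoint_compl_right_iff_subset]
    intro y hy i σ _
    have h0 := (of_mem_support_escher hG hb.isLegal hU0.le hU 0 hy).1
    rw [List.length_eq_zero_iff.1 h0]
    simp
  refine (PMF.toOuterMeasure_mono _ ?_).trans
    (toOuterMeasure_exists_estimationError_le hG b o hU0 hU hT hp0 hp1)
  rintro y ⟨hy, hys⟩
  by_contra hgood
  refine hy fun i => ?_
  obtain ⟨-, hlegal, -, hpos⟩ := of_mem_support_escher hG hb.isLegal hU0.le hU T hys
  simp only [Set.mem_iUnion, Set.mem_ofPred_eq, not_exists, not_le] at hgood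
  have hK : ∀ s ∈ G.infoSets i, ∀ a ∈ G.legalAt i s,
      (y.2.map fun f => expectedRegret i (b i) (f i) s a).sum ≤
        Real.sqrt (T * (Fintype.card (A i) * (2 * (U * (2 * G.horizon + 1))) ^ 2)) +
        Real.sqrt (8 * (1 + Nat.card ((i : Fin N) × (G.infoSets i × A i)))) *
        (2 * (U * (2 * G.horizon + 1))) * Real.sqrt T * Real.sqrt (1 + Real.log (1 / p)) := by
    intro s hs a ha
    have h1 := hgood ⟨i, ⟨s, hs⟩, a⟩
    have h2 := le_sqrt_of_squaredPositivePart_le (hpos i s) ha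
    rw [estimationError] at h1
    linarith
  refine (regretLE_of_expectedRegret_le hG hb (fun f hf => hlegal f hf i) (by positivity) hK).mono
    ?_
  -- This lets the deterministic regret matching term be absorbed into the probabilistic one.
  have hsl : 1 ≤ Real.sqrt (1 + Real.log (1 / p)) := Real.one_le_sqrt.2 (by linarith)
  rw [div_mul_eq_mul_div, div_mul_eq_mul_div]
  refine div_le_div_of_nonneg_right ?_ (minReach_nonneg b i)
  rw [Real.sqrt_mul (Nat.cast_nonneg _), Real.sqrt_mul (Nat.cast_nonneg _),
    Real.sqrt_sq hM0.le]
  refine le_trans ?_ (mul_le_mul_of_nonneg_right (mul_le_mul_of_nonneg_right (hC i)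
    (Real.sqrt_nonneg T)) (Real.sqrt_nonneg _))
  have h3 : Real.sqrt T * (Real.sqrt (Fintype.card (A i)) * (2 * (U * (2 * G.horizon + 1)))) ≤
      Real.sqrt T * (Real.sqrt (Fintype.card (A i)) * (2 * (U * (2 * G.horizon + 1)))) *
        Real.sqrt (1 + Real.log (1 / p)) :=
    le_mul_of_one_le_right (by positivity) hsl
  refine (mul_le_mul_of_nonneg_left (add_le_add_left h3 _)
    (Nat.cast_nonneg (G.infoSets i).ncard)).trans (le_of_eq ?_)
  rw [regretFactor]
  ring

end GameForm

theorem theorem1 {N : ℕ} {W : Type u} {A : Fin N → Type v} {O : Fin N → Type x}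
    [Finite W] [∀ i, Fintype (A i)] [∀ i, Nonempty (A i)]
    (G : GameForm N W A O) (hG : G.IsGame) :
    ∃ C : ℝ, 0 < C ∧ ∀ b : G.Profile, G.IsSamplingPolicy b →
      (∀ (o : UpdateOrder) (T : ℕ) (p : ℝ), 0 < p → p < 1 →
        ENNReal.ofReal (1 - p) ≤ (G.escher b o T).toOuterMeasure
          {y | ∀ i, G.RegretLE i y.2
            (C / G.minReach b i * Real.sqrt T * Real.sqrt (1 + Real.log (1 / p)))}) ∧
      (G.IsTwoPlayerZeroSum → ∀ (T : ℕ) (p : ℝ), 1 ≤ T → 0 < p → p < 1 →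
        ENNReal.ofReal (1 - p) ≤ (G.escher b .simultaneous T).toOuterMeasure
          {y | G.IsApproxNash
            ((∑ i, C / G.minReach b i) * Real.sqrt (1 + Real.log (1 / p)) / Real.sqrt T)
            (G.averagePolicy y.2)}) := by
  obtain ⟨U, hU0, hU⟩ := GameForm.exists_utilBound (G := G)
  have hnonneg : ∀ i, 0 ≤ G.regretFactor U i := fun i => by
    rw [GameForm.regretFactor]
    positivity
  -- The sum dominates every player's factor at once; the 1 keeps the constant positive.
  have hC : ∀ i, G.regretFactor U i ≤ 1 + ∑ j, G.regretFactor U j := fun i =>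
    (Finset.single_le_sum (fun j _ => hnonneg j) (Finset.mem_univ i)).trans (by linarith)
  refine ⟨1 + ∑ j, G.regretFactor U j,
    add_pos_of_pos_of_nonneg one_pos (Finset.sum_nonneg fun j _ => hnonneg j), fun b hb =>
    ⟨fun o T p hp0 hp1 => GameForm.toOuterMeasure_regretLE hG hb o hU0 hU hC T hp0 hp1,
      fun hz T p hT hp0 hp1 => ?_⟩⟩
  refine (GameForm.toOuterMeasure_regretLE hG hb .simultaneous hU0 hU hC T hp0 hp1).trans
    (PMF.toOuterMeasure_mono _ ?_)
  rintro y ⟨hy, hys⟩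
  obtain ⟨hlen, hlegal, hconst, -⟩ :=
    GameForm.of_mem_support_escher hG hb.isLegal hU0.le hU T hys
  have hne : y.2 ≠ [] := by
    rw [← List.length_pos_iff, hlen]
    exact hT
  have h := GameForm.isApproxNash_averagePolicy hG hz hne hlegal (hconst rfl) hy
  rw [Set.mem_ofPred_eq]
  convert h using 1
  rw [hlen, ← Finset.sum_mul, ← Finset.sum_mul]
  have hT0 : (0 : ℝ) < T := by exact_mod_cast hT
  have hs : Real.sqrt T ≠ 0 := (Real.sqrt_pos.2 hT0).ne'
  -- Writing the dividing `T` as `√T * √T` turns `√T / T` into `1 / √T`.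
  nth_rewrite 3 [← Real.mul_self_sqrt hT0.le]
  field_simp
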